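/- Fix an integer $k\ge 3$. For $n\ge 1$ let $\Omega_{n,k}$ be the set of all $M=\binom nk$ vectors in $GF(2)^n$ with exactly $k$ entries equal to $1$, and put $n^*=n-1$ if $k$ is even and $n^*=n$ if $k$ is odd. Order the $M$ vectors of $\Omega_{n,k}$ uniformly at random, and for $0\le m\le M$ let $\mathbf M_m$ be the $n\times m$ matrix over $GF(2)$ whose columns are the first $m$ vectors in this order. Let $$m_1=\min\{m:\ \text{all } n \text{ rows of } \mathbf M_m \text{ are nonzero}\},\qquad m^*=\min\{m:\ \mathrm{rank}(\mathbf M_m)=n^*\}.$$ Then, with probability tending to $1$ as $n\to\infty$ (with $k$ fixed), both minima exist and $m_1=m^*$. -/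

import Mathlib

open Filter Topology MeasureTheory ProbabilityTheory

/-- `Ω_{n,k}`: the vectors of length `n` over `GF(2)` with exactly `k` entries equal to `1`. -/
abbrev Omega (n k : ℕ) : Type :=
  {v : Fin n → ZMod 2 // (Finset.univ.filter fun i => v i = 1).card = k}

/-- There are `n.choose k` vectors in `Ω_{n,k}`. -/
theorem card_Omega (n k : ℕ) : Fintype.card (Omega n k) = n.choose k := by
  classical
  have hz : ∀ a : ZMod 2, (if a = 1 then (1 : ZMod 2) else 0) = a := by decide
  have e : Omega n k ≃ {s : Finset (Fin n) // s.card = k} :=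
    { toFun := fun v => ⟨Finset.univ.filter fun i => v.1 i = 1, v.2⟩
      invFun := fun s => ⟨fun i => if i ∈ s.1 then 1 else 0, by simpa using s.2⟩
      left_inv := by
        intro v
        apply Subtype.ext
        funext i
        simpa using hz (v.1 i)
      right_inv := by
        intro s
        apply Subtype.ext
        ext i
        simp }
  rw [Fintype.card_congr e, Fintype.card_finset_len, Fintype.card_fin]

/-- An ordering of all `M = n.choose k` vectors of `Ω_{n,k}`: the vector in position `j`
is `σ j`. -/
abbrev ColumnOrder (n k : ℕ) : Type := Fin (n.choose k) ≃ Omega n k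

instance instNonemptyColumnOrder (n k : ℕ) : Nonempty (ColumnOrder n k) :=
  ⟨(Fintype.equivFinOfCardEq (card_Omega n k)).symm⟩

/-- Every set of orderings is an event. -/
instance instMeasurableSpaceColumnOrder (n k : ℕ) : MeasurableSpace (ColumnOrder n k) := ⊤

instance instDiscreteMeasurableSpaceColumnOrder (n k : ℕ) :
    DiscreteMeasurableSpace (ColumnOrder n k) := ⟨fun _ => trivial⟩

/-- The law of a uniformly random ordering of the vectors of `Ω_{n,k}`. -/
noncomputable def randomOrder (n k : ℕ) : Measure (ColumnOrder n k) :=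
  uniformOn Set.univ

instance instIsProbabilityMeasureRandomOrder (n k : ℕ) :
    IsProbabilityMeasure (randomOrder n k) :=
  isProbabilityMeasure_uniformOn Set.finite_univ Set.univ_nonempty

/-- `M_m`: the matrix over `GF(2)` formed by the first `m` columns in the order `σ`
(by all the columns if `m ≥ n.choose k`). -/
def firstColumns {n k : ℕ} (σ : ColumnOrder n k) (m : ℕ) :
    Matrix (Fin n) {j : Fin (n.choose k) // (j : ℕ) < m} (ZMod 2) :=
  Matrix.of fun i j => (σ j.1).1 i

/-- The number of nonzero rows of a matrix. -/
noncomputable def numNonzeroRows {n : ℕ} {ι : Type} (A : Matrix (Fin n) ι (ZMod 2)) : ℕ :=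
  Set.ncard {i : Fin n | A i ≠ 0}

/-- `n^* = n - 1` if `k` is even and `n^* = n` if `k` is odd. -/
def nStar (n k : ℕ) : ℕ := n - (if Even k then 1 else 0)

/-!
A *kernel set* is a set `S` of rows whose sum is zero, that is, every column has an even number of
ones in the rows of `S`. A zero row is a kernel set of size one. For even `k` the set of all rows is
a kernel set, and kernel sets come in complementary pairs. So the rank is `nStar n k` exactly when
the only kernel sets are `∅` and, for even `k`, the set of all rows, and then no row is zero
(`not_zeroRow_of_rank_eq`, `rank_eq_nStar`). It remains to exclude, with high probability, a
nontrivial kernel set at the time the last zero row disappears.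

Put `L = log n` and consider a time `m` close to `(n / k) * (L - log L / 2)`, when about `√L` rows
are expected to be zero. The two hitting times agree as soon as four events fail
(`exists_isLeast_and_isLeast`), and each of them has a probability that tends to zero.

* At time `m` there is a kernel set with a nonzero row (`prob_exists_kernelSet_le`, a first moment
  bound). For `|S| * L ≤ n`, some column meets `S` at least twice, which costs a factor
  of order `L * |S| ^ 2 / n`, and the sum over all such `S` is at most `exp (O(√L)) * L / n`. The
  factor `exp (O(√L))` is small in comparison with `n = exp L`, which is the reason for the choice
  of `m`. For larger `S`, a column meets `S` oddly with probability at least `4 ^ (-k) * |S| / n`,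
  and a geometric series remains; for even `k` only one set of each complementary pair is counted.
* A column between time `m` and a late time meets two of the rows that are zero at time `m`
  (`prob_exists_pair_le`). If no column does so, each column meets a kernel set made of such rows at
  most once, hence not at all, so its rows are still zero.
* Some row is still zero at the late time (`prob_exists_zeroRow_le`).
* No row is zero at time `m` (`prob_forall_not_zeroRow_le_div`). This is the second moment method:
  two rows being zero are nonpositively correlated events for sampling without replacement.

Sampling without replacement is handled by exchanging positions: given the entries in a set `T` of
positions, the remaining ones are exchangeable (`card_compl_mul_prob`).
-/

/-! ### Uniform probability on a finite type -/

open Classical in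
/-- The probability of `p` under the uniform law on a finite type: the proportion of the elements
that satisfy `p`. -/
noncomputable def prob {Ω : Type*} [Fintype Ω] (p : Ω → Prop) : ℝ :=
  ((Finset.univ.filter p).card : ℝ) / Fintype.card Ω

section Prob

variable {Ω : Type*} [Fintype Ω]

theorem prob_eq_card_div (p : Ω → Prop) [DecidablePred p] :
    prob p = ((Finset.univ.filter p).card : ℝ) / Fintype.card Ω := by
  unfold prob
  congr!

theorem prob_nonneg (p : Ω → Prop) : 0 ≤ prob p := by
  unfold prob; positivity

theorem prob_mono {p q : Ω → Prop} (h : ∀ ω, p ω → q ω) : prob p ≤ prob q := by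
  classical
  unfold prob
  gcongr with ω
  exact h ω

theorem prob_congr {p q : Ω → Prop} (h : ∀ ω, p ω ↔ q ω) : prob p = prob q :=
  le_antisymm (prob_mono fun ω => (h ω).1) (prob_mono fun ω => (h ω).2)

theorem prob_le_one (p : Ω → Prop) : prob p ≤ 1 := by
  classical
  unfold prob
  apply div_le_one_of_le₀ _ (by positivity)
  exact_mod_cast Finset.card_le_univ _

theorem prob_true [Nonempty Ω] : prob (fun _ : Ω => True) = 1 := by
  classical
  simp [prob, Finset.card_univ]

theorem prob_or_le (p q : Ω → Prop) : prob (fun ω => p ω ∨ q ω) ≤ prob p + prob q := by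
  classical
  rw [prob_eq_card_div p, prob_eq_card_div q, prob_eq_card_div, ← add_div, Finset.filter_or]
  gcongr
  exact_mod_cast Finset.card_union_le _ _

theorem prob_exists_le {ι : Type*} (s : Finset ι) (p : ι → Ω → Prop) :
    prob (fun ω => ∃ i ∈ s, p i ω) ≤ ∑ i ∈ s, prob (p i) := by
  classical
  simp only [prob_eq_card_div]
  rw [← Finset.sum_div]
  gcongr
  have : (Finset.univ.filter fun ω => ∃ i ∈ s, p i ω)
      = s.biUnion fun i => Finset.univ.filter (p i) := by
    ext ω; simp
  rw [this]
  exact_mod_cast Finset.card_biUnion_le (s := s) (t := fun i => Finset.univ.filter (p i))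

theorem one_sub_prob_not_le [Nonempty Ω] (p : Ω → Prop) : 1 - prob (fun ω => ¬ p ω) ≤ prob p := by
  have h := prob_or_le p (fun ω => ¬ p ω)
  rw [prob_congr (q := fun _ => True) (fun ω => by simpa using em (p ω)), prob_true] at h
  linarith

theorem prob_eq_sum (p : Ω → Prop) [DecidablePred p] :
    prob p = (∑ ω, if p ω then (1 : ℝ) else 0) / Fintype.card Ω := by
  classical
  unfold prob
  rw [Finset.sum_boole]
  congr!

/-- The second moment method: if events of equal probability `a` are pairwise nonpositively
correlated, then the probability that none of them happens is at most the inverse of the expected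
number of those that do. -/
theorem prob_forall_not_le [Nonempty Ω] {ι : Type*} [Fintype ι] (p : ι → Ω → Prop) {a : ℝ}
    (h1 : ∀ i, prob (p i) = a) (h2 : ∀ i j, i ≠ j → prob (fun ω => p i ω ∧ p j ω) ≤ a ^ 2)
    (ha : 0 < Fintype.card ι * a) :
    prob (fun ω => ∀ i, ¬ p i ω) ≤ 1 / (Fintype.card ι * a) := by
  classical
  set μ : ℝ := Fintype.card ι * a with hμ
  set N : ℝ := (Fintype.card Ω : ℝ) with hN
  have hNpos : 0 < N := by rw [hN]; exact_mod_cast Fintype.card_pos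
  let X : Ω → ℝ := fun ω => ∑ i, if p i ω then (1 : ℝ) else 0
  have hX1 : ∑ ω, X ω = μ * N := by
    simp only [X]
    rw [Finset.sum_comm]
    have : ∀ i, (∑ ω, if p i ω then (1 : ℝ) else 0) = a * N := by
      intro i
      have := h1 i
      rw [prob_eq_sum, div_eq_iff hNpos.ne'] at this
      exact this
    simp only [this, Finset.sum_const, Finset.card_univ, nsmul_eq_mul]
    rw [hμ]; ring
  have hX2 : ∑ ω, X ω ^ 2 ≤ (μ + μ ^ 2) * N := by
    have e : ∀ ω, X ω ^ 2 = ∑ i, ∑ j, if p i ω ∧ p j ω then (1 : ℝ) else 0 := by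
      intro ω
      simp only [X, sq, Finset.sum_mul_sum]
      refine Finset.sum_congr rfl fun i _ => Finset.sum_congr rfl fun j _ => ?_
      by_cases hi : p i ω <;> by_cases hj : p j ω <;> simp [hi, hj]
    simp only [e]
    rw [Finset.sum_comm]
    have hb : ∀ i j, (∑ ω, if p i ω ∧ p j ω then (1 : ℝ) else 0)
        ≤ ((if i = j then a else 0) + a ^ 2) * N := by
      intro i j
      rw [← div_le_iff₀ hNpos, ← prob_eq_sum]
      by_cases hij : i = j
      · subst hij
        simp only [and_self, if_true, h1]
        nlinarith [sq_nonneg a]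
      · simpa [hij] using h2 i j hij
    calc ∑ i, ∑ ω, ∑ j, (if p i ω ∧ p j ω then (1 : ℝ) else 0)
        = ∑ i, ∑ j, ∑ ω, (if p i ω ∧ p j ω then (1 : ℝ) else 0) :=
          Finset.sum_congr rfl fun i _ => Finset.sum_comm
      _ ≤ ∑ i : ι, ∑ j : ι, ((if i = j then a else 0) + a ^ 2) * N :=
          Finset.sum_le_sum fun i _ => Finset.sum_le_sum fun j _ => hb i j
      _ = (μ + μ ^ 2) * N := by
          simp only [← Finset.sum_mul, Finset.sum_add_distrib, Finset.sum_ite_eq, Finset.mem_univ,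
            if_true, Finset.sum_const, Finset.card_univ, nsmul_eq_mul]
          rw [hμ]; ring
  have hvar : ∑ ω, (X ω - μ) ^ 2 ≤ μ * N := by
    have : ∑ ω, (X ω - μ) ^ 2 = ∑ ω, X ω ^ 2 - 2 * μ * ∑ ω, X ω + μ ^ 2 * N := by
      rw [Finset.mul_sum, ← Finset.sum_sub_distrib, hN, mul_comm (μ ^ 2), ← nsmul_eq_mul,
        ← Finset.card_univ, ← Finset.sum_const, ← Finset.sum_add_distrib]
      exact Finset.sum_congr rfl fun ω _ => by ring
    rw [this, hX1]
    nlinarith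
  have hlow : (∑ ω, if ∀ i, ¬ p i ω then (1 : ℝ) else 0) * μ ^ 2 ≤ ∑ ω, (X ω - μ) ^ 2 := by
    rw [Finset.sum_mul]
    refine Finset.sum_le_sum fun ω _ => ?_
    split_ifs with h
    · have : X ω = 0 := Finset.sum_eq_zero fun i _ => if_neg (h i)
      rw [this]; apply le_of_eq; ring
    · rw [zero_mul]; positivity
  rw [prob_eq_sum, div_le_div_iff₀ hNpos ha]
  have := hlow.trans hvar
  nlinarith

end Prob

theorem randomOrder_real_eq_prob (n k : ℕ) (A : Set (ColumnOrder n k)) :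
    (randomOrder n k).real A = prob (fun σ => σ ∈ A) := by
  classical
  rw [Measure.real, randomOrder, uniformOn_univ, Measure.count_apply (by trivial),
    ENNReal.toReal_div, prob]
  congr 1
  rw [Set.encard_eq_coe_toFinset_card]
  simp

/-! ### Random bijections -/

section Bijection

variable {ι α : Type*} [Fintype ι] [DecidableEq ι] [Fintype α] [DecidableEq α]

/-- Two positions outside `T` are exchangeable even when the entries in `T` are prescribed to lie
in `F`. -/
theorem prob_forall_mem_and_swap (T : Finset ι) (F B : Finset α) {p q : ι} (hp : p ∉ T)
    (hq : q ∉ T) :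
    prob (fun σ : ι ≃ α => (∀ i ∈ T, σ i ∈ F) ∧ σ p ∈ B)
      = prob (fun σ : ι ≃ α => (∀ i ∈ T, σ i ∈ F) ∧ σ q ∈ B) := by
  classical
  unfold prob
  congr 2
  refine Finset.card_bij' (fun σ _ => (Equiv.swap p q).trans σ)
    (fun σ _ => (Equiv.swap p q).trans σ) ?_ ?_ ?_ ?_
  · simp only [Finset.mem_filter, Finset.mem_univ, true_and, Equiv.trans_apply,
      Equiv.swap_apply_right]
    rintro σ ⟨h, h'⟩
    refine ⟨fun i hi => ?_, h'⟩
    rw [Equiv.swap_apply_of_ne_of_ne (by rintro rfl; exact hp hi) (by rintro rfl; exact hq hi)]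
    exact h i hi
  · simp only [Finset.mem_filter, Finset.mem_univ, true_and, Equiv.trans_apply,
      Equiv.swap_apply_left]
    rintro σ ⟨h, h'⟩
    refine ⟨fun i hi => ?_, h'⟩
    rw [Equiv.swap_apply_of_ne_of_ne (by rintro rfl; exact hp hi) (by rintro rfl; exact hq hi)]
    exact h i hi
  · intro σ _; ext i; simp
  · intro σ _; ext i; simp

/-- Averaging over the position `p ∉ T`: the conditional probability that the entry in position `p`
lies in `B` is the expected share of `B` in the entries outside `T`. -/
theorem card_compl_mul_prob (T : Finset ι) (F B : Finset α) {p : ι} (hp : p ∉ T) :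
    (Tᶜ.card : ℝ) * prob (fun σ : ι ≃ α => (∀ i ∈ T, σ i ∈ F) ∧ σ p ∈ B)
      = (∑ σ : ι ≃ α, if ∀ i ∈ T, σ i ∈ F then ((Tᶜ.filter fun q => σ q ∈ B).card : ℝ) else 0)
        / Fintype.card (ι ≃ α) := by
  classical
  have : (Tᶜ.card : ℝ) * prob (fun σ : ι ≃ α => (∀ i ∈ T, σ i ∈ F) ∧ σ p ∈ B)
      = ∑ q ∈ Tᶜ, prob (fun σ : ι ≃ α => (∀ i ∈ T, σ i ∈ F) ∧ σ q ∈ B) := by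
    rw [← nsmul_eq_mul, ← Finset.sum_const]
    exact Finset.sum_congr rfl fun q hq =>
      prob_forall_mem_and_swap T F B hp (Finset.mem_compl.1 hq)
  rw [this]
  simp only [prob_eq_sum]
  rw [← Finset.sum_div, Finset.sum_comm]
  congr 1
  refine Finset.sum_congr rfl fun σ _ => ?_
  by_cases h : ∀ i ∈ T, σ i ∈ F
  · rw [if_pos h]
    simp only [and_iff_right h, Finset.sum_boole]
  · simp only [h, false_and, if_false, Finset.sum_const_zero]

theorem card_compl_mul_prob_le (T : Finset ι) (F B : Finset α) {p : ι} (hp : p ∉ T) :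
    (Tᶜ.card : ℝ) * prob (fun σ : ι ≃ α => (∀ i ∈ T, σ i ∈ F) ∧ σ p ∈ B)
      ≤ B.card * prob (fun σ : ι ≃ α => ∀ i ∈ T, σ i ∈ F) := by
  classical
  rw [card_compl_mul_prob T F B hp, prob_eq_sum, mul_div_assoc', Finset.mul_sum]
  gcongr with σ
  split_ifs
  · rw [mul_one]
    exact_mod_cast Finset.card_le_card_of_injOn σ
      (fun q hq => by simpa using (Finset.mem_filter.1 hq).2) σ.injective.injOn
  · simp

theorem card_compl_mul_prob_insert (T : Finset ι) (F : Finset α) {p : ι} (hp : p ∉ T) :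
    (Tᶜ.card : ℝ) * prob (fun σ : ι ≃ α => ∀ i ∈ insert p T, σ i ∈ F)
      = (F.card - T.card) * prob (fun σ : ι ≃ α => ∀ i ∈ T, σ i ∈ F) := by
  classical
  have e : ∀ σ : ι ≃ α, (∀ i ∈ insert p T, σ i ∈ F) ↔ ((∀ i ∈ T, σ i ∈ F) ∧ σ p ∈ F) := by
    intro σ; rw [Finset.forall_mem_insert, and_comm]
  rw [prob_congr e, card_compl_mul_prob T F F hp, prob_eq_sum, mul_div_assoc', Finset.mul_sum]
  congr 1
  refine Finset.sum_congr rfl fun σ _ => ?_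
  split_ifs with h
  · have h1 : (Tᶜ.filter fun q => σ q ∈ F).card + T.card = F.card := by
      have : (F.map σ.symm.toEmbedding).card = F.card := Finset.card_map _
      rw [← this, ← Finset.card_union_of_disjoint]
      · congr 1
        ext q
        simp only [Finset.mem_union, Finset.mem_filter, Finset.mem_compl, Finset.mem_map_equiv,
          Equiv.symm_symm]
        by_cases hq : q ∈ T
        · simp [hq, h q hq]
        · simp [hq]
      · rw [Finset.disjoint_left]
        intro q hq hq'
        simp [hq'] at hq
    rw [mul_one, ← h1]; push_cast; ring
  · simp

/-- Sampling without replacement is dominated by sampling with replacement. -/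
theorem prob_forall_mem_le (T : Finset ι) (F : Finset α) (e : Nonempty (ι ≃ α)) :
    prob (fun σ : ι ≃ α => ∀ i ∈ T, σ i ∈ F)
      ≤ ((F.card : ℝ) / Fintype.card ι) ^ T.card := by
  classical
  have hcard : Fintype.card ι = Fintype.card α := Fintype.card_congr e.some
  induction T using Finset.induction_on with
  | empty => simpa using prob_le_one _
  | insert p T hp ih =>
    have h := card_compl_mul_prob_insert (α := α) T F hp
    have hc : Tᶜ.card + T.card = Fintype.card ι := by
      rw [add_comm]; exact Finset.card_add_card_compl T
    have hcR : (Tᶜ.card : ℝ) = Fintype.card ι - T.card := by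
      rw [← hc]; push_cast; ring
    have hpos : 0 < (Tᶜ.card : ℝ) := by
      exact_mod_cast Finset.card_pos.2 ⟨p, Finset.mem_compl.2 hp⟩
    have hF : (F.card : ℝ) ≤ Fintype.card ι := by
      rw [hcard]; exact_mod_cast Finset.card_le_univ F
    have hι : (0 : ℝ) < Fintype.card ι := by
      have : (0 : ℝ) ≤ T.card := by positivity
      linarith
    rw [Finset.card_insert_of_notMem hp, pow_succ, mul_comm (_ ^ _)]
    set P := prob (fun σ : ι ≃ α => ∀ i ∈ T, σ i ∈ F) with hP
    have hP0 : 0 ≤ P := prob_nonneg _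
    set Q := prob (fun σ : ι ≃ α => ∀ i ∈ insert p T, σ i ∈ F)
    have h2 : Q ≤ (F.card : ℝ) / Fintype.card ι * P := by
      rw [div_mul_eq_mul_div, le_div_iff₀ hι]
      refine le_of_mul_le_mul_left ?_ hpos
      rw [← mul_assoc, h, hcR]
      have hT : (0 : ℝ) ≤ T.card := by positivity
      nlinarith [mul_nonneg (mul_nonneg hT (sub_nonneg.2 hF)) hP0]
    exact h2.trans (by gcongr)

/-- The exact law of sampling without replacement. -/
theorem prob_forall_mem_eq (T : Finset ι) (F : Finset α) (e : Nonempty (ι ≃ α)) :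
    prob (fun σ : ι ≃ α => ∀ i ∈ T, σ i ∈ F)
      = ∏ j ∈ Finset.range T.card, (((F.card : ℝ) - j) / (Fintype.card ι - j)) := by
  classical
  induction T using Finset.induction_on with
  | empty =>
    have := e
    simpa using prob_true (Ω := ι ≃ α)
  | insert p T hp ih =>
    have h := card_compl_mul_prob_insert (α := α) T F hp
    have hc : Tᶜ.card + T.card = Fintype.card ι := by
      rw [add_comm]; exact Finset.card_add_card_compl T
    have hcR : (Tᶜ.card : ℝ) = Fintype.card ι - T.card := by
      rw [← hc]; push_cast; ring
    have hpos : 0 < (Tᶜ.card : ℝ) := by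
      exact_mod_cast Finset.card_pos.2 ⟨p, Finset.mem_compl.2 hp⟩
    rw [Finset.card_insert_of_notMem hp, Finset.prod_range_succ, ← ih, ← hcR, ← mul_div_assoc,
      eq_div_iff hpos.ne', mul_comm, h, mul_comm]

end Bijection

/-! ### Counting the columns that meet a set of rows in a prescribed way -/

/-- The set of rows in which a column has its ones. -/
def colSupp {n k : ℕ} (v : Omega n k) : Finset (Fin n) :=
  Finset.univ.filter fun i => v.1 i = 1

section Counting

variable {n k : ℕ}

theorem card_colSupp (v : Omega n k) : (colSupp v).card = k := v.2

theorem colSupp_injective : Function.Injective (colSupp : Omega n k → Finset (Fin n)) := by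
  intro v w h
  apply Subtype.ext
  funext i
  have hz : ∀ a b : ZMod 2, (a = 1 ↔ b = 1) → a = b := by decide
  apply hz
  have := congrArg (i ∈ ·) h
  simpa [colSupp] using this

theorem card_filter_colSupp (P : Finset (Fin n) → Prop) [DecidablePred P] :
    (Finset.univ.filter fun v : Omega n k => P (colSupp v)).card
      = ((Finset.powersetCard k Finset.univ).filter P).card := by
  classical
  rw [← Finset.card_image_of_injective _ colSupp_injective]
  congr 1
  ext A
  simp only [Finset.mem_image, Finset.mem_filter, Finset.mem_univ, true_and,
    Finset.mem_powersetCard_univ]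
  constructor
  · rintro ⟨v, hv, rfl⟩
    exact ⟨card_colSupp v, hv⟩
  · rintro ⟨hA, hP⟩
    have : colSupp (⟨fun i => if i ∈ A then 1 else 0, by simpa using hA⟩ : Omega n k) = A := by
      ext i; simp [colSupp]
    exact ⟨_, by rwa [this], this⟩

/-- The columns without a one in the rows of `S`. -/
def avoiding (k : ℕ) (S : Finset (Fin n)) : Finset (Omega n k) :=
  Finset.univ.filter fun v => Disjoint (colSupp v) S

/-- The columns with at least two ones in the rows of `S`. -/
def meetingTwice (k : ℕ) (S : Finset (Fin n)) : Finset (Omega n k) :=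
  Finset.univ.filter fun v => 2 ≤ (colSupp v ∩ S).card

/-- The columns orthogonal to the indicator vector of `S`. -/
def meetingEvenly (k : ℕ) (S : Finset (Fin n)) : Finset (Omega n k) :=
  Finset.univ.filter fun v => Even (colSupp v ∩ S).card

theorem card_avoiding (S : Finset (Fin n)) :
    (avoiding k S).card = (n - S.card).choose k := by
  classical
  rw [avoiding, card_filter_colSupp (fun A => Disjoint A S)]
  have : (Finset.powersetCard k Finset.univ).filter (fun A => Disjoint A S)
      = Finset.powersetCard k Sᶜ := by
    ext A
    simp only [Finset.mem_filter, Finset.mem_powersetCard, Finset.subset_univ, true_and,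
      Finset.subset_compl_iff_disjoint_right]
    exact and_comm
  rw [this, Finset.card_powersetCard, Finset.card_compl, Fintype.card_fin]

theorem card_superset_le {T : Finset (Fin n)} (hT : T.card = 2) :
    (Finset.univ.filter fun v : Omega n k => T ⊆ colSupp v).card ≤ (n - 2).choose (k - 2) := by
  classical
  rw [card_filter_colSupp (fun A => T ⊆ A)]
  have h : (Finset.powersetCard (k - 2) Tᶜ).card = (n - 2).choose (k - 2) := by
    rw [Finset.card_powersetCard, Finset.card_compl, Fintype.card_fin, hT]
  rw [← h]
  refine Finset.card_le_card_of_injOn (fun A => A \ T) ?_ ?_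
  · intro A hA
    simp only [Finset.coe_filter, Finset.mem_powersetCard_univ, Set.mem_ofPred_eq] at hA
    rw [Finset.mem_coe, Finset.mem_powersetCard]
    refine ⟨fun i hi => Finset.mem_compl.2 (Finset.mem_sdiff.1 hi).2, ?_⟩
    rw [Finset.card_sdiff_of_subset hA.2, hA.1, hT]
  · intro A hA B hB hAB
    simp only [Finset.coe_filter, Finset.mem_powersetCard_univ, Set.mem_ofPred_eq] at hA hB
    rw [← Finset.sdiff_union_of_subset hA.2, ← Finset.sdiff_union_of_subset hB.2]
    exact congrArg (· ∪ T) hAB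

theorem card_meetingTwice_le (S : Finset (Fin n)) :
    (meetingTwice k S).card ≤ S.card.choose 2 * (n - 2).choose (k - 2) := by
  classical
  have hsub : meetingTwice k S
      ⊆ (S.powersetCard 2).biUnion fun T => Finset.univ.filter fun v => T ⊆ colSupp v := by
    intro v hv
    obtain ⟨T, hT, hc⟩ := Finset.exists_subset_card_eq (Finset.mem_filter.1 hv).2
    simp only [Finset.mem_biUnion, Finset.mem_powersetCard, Finset.mem_filter, Finset.mem_univ,
      true_and]
    exact ⟨T, ⟨hT.trans Finset.inter_subset_right, hc⟩, hT.trans Finset.inter_subset_left⟩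
  refine (Finset.card_le_card hsub).trans ?_
  rw [← Finset.card_powersetCard]
  exact Finset.card_biUnion_le_card_mul _ _ _ fun T hT =>
    card_superset_le (Finset.mem_powersetCard.1 hT).2

theorem meetingEvenly_subset (S : Finset (Fin n)) :
    meetingEvenly k S ⊆ avoiding k S ∪ meetingTwice k S := by
  classical
  intro v hv
  have h := (Finset.mem_filter.1 hv).2
  simp only [Finset.mem_union, avoiding, meetingTwice, Finset.mem_filter, Finset.mem_univ, true_and,
    Finset.disjoint_iff_inter_eq_empty, ← Finset.card_eq_zero]
  obtain ⟨r, hr⟩ := h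
  omega

theorem card_meetingEvenly_add_le (hk : 1 ≤ k) (S : Finset (Fin n)) :
    (meetingEvenly k S).card + S.card * (n - S.card).choose (k - 1) ≤ n.choose k := by
  classical
  have h1 : S.card * (n - S.card).choose (k - 1)
      ≤ (Finset.univ.filter fun v : Omega n k => ¬ Even (colSupp v ∩ S).card).card := by
    rw [card_filter_colSupp (fun A => ¬ Even (A ∩ S).card)]
    have h : (S ×ˢ Finset.powersetCard (k - 1) Sᶜ).card
        = S.card * (n - S.card).choose (k - 1) := by
      rw [Finset.card_product, Finset.card_powersetCard, Finset.card_compl, Fintype.card_fin]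
    rw [← h]
    have hins : ∀ i ∈ S, ∀ A : Finset (Fin n), A ⊆ Sᶜ → insert i A ∩ S = {i} := by
      intro i hi A hA
      ext j
      simp only [Finset.mem_inter, Finset.mem_insert, Finset.mem_singleton]
      constructor
      · rintro ⟨rfl | hj, hjS⟩
        · rfl
        · exact absurd hjS (Finset.mem_compl.1 (hA hj))
      · rintro rfl; exact ⟨Or.inl rfl, hi⟩
    refine Finset.card_le_card_of_injOn (fun x => insert x.1 x.2) ?_ ?_
    · rintro ⟨i, A⟩ hx
      simp only [Finset.coe_product, Set.mem_prod, Finset.mem_coe, Finset.mem_powersetCard] at hx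
      obtain ⟨hi, hA, hc⟩ := hx
      simp only [Finset.coe_filter, Finset.mem_powersetCard_univ, Set.mem_ofPred_eq]
      rw [hins i hi A hA, Finset.card_insert_of_notMem
        (fun h => Finset.mem_compl.1 (hA h) hi), hc]
      refine ⟨by omega, by simp⟩
    · rintro ⟨i, A⟩ hx ⟨j, B⟩ hy hxy
      simp only [Finset.coe_product, Set.mem_prod, Finset.mem_coe, Finset.mem_powersetCard]
        at hx hy
      obtain ⟨hi, hA, -⟩ := hx
      obtain ⟨hj, hB, -⟩ := hy
      simp only at hxy
      have hij : i = j := by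
        have := hins i hi A hA
        rw [hxy, hins j hj B hB] at this
        exact (Finset.singleton_injective this).symm
      subst hij
      have : A = B := by
        rw [← Finset.erase_insert (fun h => Finset.mem_compl.1 (hA h) hi),
          ← Finset.erase_insert (fun h => Finset.mem_compl.1 (hB h) hi)]
        rw [hxy]
      rw [this]
  have h2 := Finset.card_filter_add_card_filter_not (s := (Finset.univ : Finset (Omega n k)))
    (fun v => Even (colSupp v ∩ S).card)
  rw [Finset.card_univ, card_Omega] at h2
  unfold meetingEvenly
  omega

theorem card_meetingEvenly_add_le_of_odd (hk : Odd k) (S : Finset (Fin n)) :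
    (meetingEvenly k S).card + S.card.choose k ≤ n.choose k := by
  classical
  have h1 : S.card.choose k
      ≤ (Finset.univ.filter fun v : Omega n k => ¬ Even (colSupp v ∩ S).card).card := by
    rw [card_filter_colSupp (fun A => ¬ Even (A ∩ S).card), ← Finset.card_powersetCard]
    refine Finset.card_le_card fun A hA => ?_
    obtain ⟨hA, hc⟩ := Finset.mem_powersetCard.1 hA
    rw [Finset.mem_filter, Finset.mem_powersetCard_univ, Finset.inter_eq_left.2 hA, hc]
    exact ⟨rfl, Nat.not_even_iff_odd.2 hk⟩
  have h2 := Finset.card_filter_add_card_filter_not (s := (Finset.univ : Finset (Omega n k)))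
    (fun v => Even (colSupp v ∩ S).card)
  rw [Finset.card_univ, card_Omega] at h2
  unfold meetingEvenly
  omega

end Counting

/-! ### Ratios of binomial coefficients -/

theorem descFactorial_mul_pow_le {a n : ℕ} (h : a ≤ n) (k : ℕ) :
    a.descFactorial k * n ^ k ≤ n.descFactorial k * a ^ k := by
  induction k with
  | zero => simp
  | succ k ih =>
    rw [Nat.descFactorial_succ, Nat.descFactorial_succ, pow_succ, pow_succ]
    have h1 : (a - k) * n ≤ (n - k) * a := by
      rw [Nat.sub_mul, Nat.sub_mul, mul_comm n a]
      exact Nat.sub_le_sub_left (Nat.mul_le_mul_left k h) _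
    calc (a - k) * a.descFactorial k * (n ^ k * n)
        = ((a - k) * n) * (a.descFactorial k * n ^ k) := by ring
      _ ≤ ((n - k) * a) * (n.descFactorial k * a ^ k) := Nat.mul_le_mul h1 ih
      _ = _ := by ring

theorem choose_mul_pow_le {a n : ℕ} (h : a ≤ n) (k : ℕ) :
    a.choose k * n ^ k ≤ n.choose k * a ^ k := by
  have := descFactorial_mul_pow_le h k
  rw [Nat.descFactorial_eq_factorial_mul_choose, Nat.descFactorial_eq_factorial_mul_choose,
    mul_assoc, mul_assoc] at this
  exact Nat.le_of_mul_le_mul_left this (Nat.factorial_pos k)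

theorem choose_sub_le_exp_mul {n s : ℕ} (hn : 0 < n) (hs : s ≤ n) (k : ℕ) :
    ((n - s).choose k : ℝ) ≤ Real.exp (-(k * s / n)) * n.choose k := by
  have hn' : (0 : ℝ) < n := by exact_mod_cast hn
  have h : ((n - s).choose k : ℝ) * n ^ k ≤ n.choose k * ((n : ℝ) - s) ^ k := by
    have := choose_mul_pow_le (Nat.sub_le n s) k
    rw [← Nat.cast_sub hs]
    exact_mod_cast this
  have h2 : ((n : ℝ) - s) ^ k ≤ Real.exp (-(k * s / n)) * n ^ k := by
    have : (n : ℝ) - s ≤ Real.exp (-(s / n)) * n := by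
      have := Real.add_one_le_exp (-(s / n : ℝ))
      calc (n : ℝ) - s = (-(s / n) + 1) * n := by field_simp; ring
        _ ≤ _ := by gcongr
    calc ((n : ℝ) - s) ^ k ≤ (Real.exp (-(s / n)) * n) ^ k := by
          apply pow_le_pow_left₀ _ this
          rw [sub_nonneg]; exact_mod_cast hs
      _ = Real.exp (-(k * s / n)) * n ^ k := by
          rw [mul_pow, ← Real.exp_nat_mul]; congr 2; ring
  have h3 : (0 : ℝ) < (n : ℝ) ^ k := by positivity
  refine le_of_mul_le_mul_right (h.trans ?_) h3
  calc (n.choose k : ℝ) * ((n : ℝ) - s) ^ k ≤ n.choose k * (Real.exp (-(k * s / n)) * n ^ k) := by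
        gcongr
    _ = _ := by ring

/-- The share of the `k`-sets that contain a given pair. -/
theorem choose_sub_two_le {n k : ℕ} (hk : 2 ≤ k) (hkn : k ≤ n) :
    ((n - 2).choose (k - 2) : ℝ) ≤ (k * (k - 1)) / (n * (n - 1)) * n.choose k := by
  obtain ⟨j, rfl⟩ := Nat.exists_eq_add_of_le' hk
  obtain ⟨r, rfl⟩ := Nat.exists_eq_add_of_le' (hk.trans hkn)
  have h1 := Nat.add_one_mul_choose_eq (r + 1) (j + 1)
  have h2 := Nat.add_one_mul_choose_eq r j
  have e1 : ((r : ℝ) + 2) * (r + 1).choose (j + 1) = (r + 2).choose (j + 2) * (j + 2) := by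
    exact_mod_cast h1
  have e2 : ((r : ℝ) + 1) * r.choose j = (r + 1).choose (j + 1) * (j + 1) := by
    exact_mod_cast h2
  simp only [Nat.add_sub_cancel]
  push_cast
  have hr : (r : ℝ) + 2 - 1 = r + 1 := by ring
  have hj : (j : ℝ) + 2 - 1 = j + 1 := by ring
  rw [hr, hj, div_mul_eq_mul_div, le_div_iff₀ (by positivity)]
  apply le_of_eq
  calc (r.choose j : ℝ) * ((r + 2) * (r + 1)) = (r + 2) * ((r + 1) * r.choose j) := by ring
    _ = ((r + 2) * (r + 1).choose (j + 1)) * (j + 1) := by rw [e2]; ring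
    _ = _ := by rw [e1]; ring

theorem div_pair_le {n k : ℕ} (hk : 2 ≤ k) (hkn : k ≤ n) :
    ((k : ℝ) * (k - 1)) / (n * (n - 1)) ≤ k ^ 2 / n ^ 2 := by
  have h2 : (2 : ℝ) ≤ k := by exact_mod_cast hk
  have hn : (k : ℝ) ≤ n := by exact_mod_cast hkn
  rw [div_le_div_iff₀ (by nlinarith) (by nlinarith)]
  have : 0 ≤ (k : ℝ) * n * (n - k) := by
    have : 0 ≤ (n : ℝ) - k := by linarith
    have : (0 : ℝ) ≤ n := by linarith
    positivity
  nlinarith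

theorem card_superset_le_mul {n k : ℕ} (hk : 2 ≤ k) (hkn : k ≤ n) {T : Finset (Fin n)}
    (hT : T.card = 2) :
    ((Finset.univ.filter fun v : Omega n k => T ⊆ colSupp v).card : ℝ)
      ≤ (k : ℝ) ^ 2 / n ^ 2 * n.choose k :=
  calc _ ≤ ((n - 2).choose (k - 2) : ℝ) := by exact_mod_cast card_superset_le hT
    _ ≤ _ := choose_sub_two_le hk hkn
    _ ≤ _ := by gcongr ?_ * _; exact div_pair_le hk hkn

theorem card_meetingTwice_le_mul {n k : ℕ} (hk : 2 ≤ k) (hkn : k ≤ n) (S : Finset (Fin n)) :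
    ((meetingTwice k S).card : ℝ) ≤ (k : ℝ) ^ 2 * S.card ^ 2 / n ^ 2 * n.choose k := by
  have h1 : ((meetingTwice k S).card : ℝ) ≤ S.card.choose 2 * (n - 2).choose (k - 2) := by
    exact_mod_cast card_meetingTwice_le S
  have h2 : (S.card.choose 2 : ℝ) ≤ S.card ^ 2 := by
    exact_mod_cast Nat.choose_le_pow S.card 2
  calc _ ≤ _ := h1
    _ ≤ S.card ^ 2 * (k ^ 2 / n ^ 2 * n.choose k) := by
      gcongr
      exact (choose_sub_two_le hk hkn).trans (by gcongr ?_ * _; exact div_pair_le hk hkn)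
    _ = _ := by ring

theorem card_avoiding_le_mul {n : ℕ} (k : ℕ) (hn : 0 < n) (S : Finset (Fin n)) :
    ((avoiding k S).card : ℝ) ≤ Real.exp (-(k * S.card / n)) * n.choose k := by
  rw [card_avoiding]
  exact choose_sub_le_exp_mul hn (by simpa using Finset.card_le_univ S) k

/-- A bound on the number of columns orthogonal to `S` that is sharp for small `S`. -/
theorem card_meetingEvenly_le_of_small {n k : ℕ} (hk : 2 ≤ k) (hkn : k ≤ n) (S : Finset (Fin n)) :
    ((meetingEvenly k S).card : ℝ)
      ≤ (Real.exp (-(k * S.card / n)) + (k : ℝ) ^ 2 * S.card ^ 2 / n ^ 2) * n.choose k := by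
  classical
  have h : ((meetingEvenly k S).card : ℝ) ≤ (avoiding k S).card + (meetingTwice k S).card := by
    exact_mod_cast (Finset.card_le_card (meetingEvenly_subset S)).trans (Finset.card_union_le _ _)
  have h1 := card_avoiding_le_mul k (n := n) (by omega) S
  have h2 := card_meetingTwice_le_mul hk hkn S
  rw [add_mul]
  linarith

theorem choose_le_four_pow_mul_choose {n a j : ℕ} (h : n + 4 * j ≤ 4 * a) :
    (n.choose j : ℝ) ≤ 4 ^ j * a.choose j := by
  have h1 : n.descFactorial j ≤ n ^ j := Nat.descFactorial_le_pow n j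
  have h2 : (a + 1 - j) ^ j ≤ a.descFactorial j := Nat.pow_sub_le_descFactorial a j
  have h3 : n ^ j ≤ (4 * (a + 1 - j)) ^ j := Nat.pow_le_pow_left (by omega) j
  have h4 : n.descFactorial j ≤ 4 ^ j * a.descFactorial j := by
    rw [mul_pow] at h3
    exact h1.trans (h3.trans (Nat.mul_le_mul_left _ h2))
  rw [Nat.descFactorial_eq_factorial_mul_choose, Nat.descFactorial_eq_factorial_mul_choose,
    mul_left_comm] at h4
  exact_mod_cast Nat.le_of_mul_le_mul_left h4 (Nat.factorial_pos j)

/-- A bound on the number of columns orthogonal to `S` for `S` of any size, up to passing to the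
complement when `k` is even. It comes from the columns with exactly one entry in `S` or, for large
`S` and odd `k`, with all entries in `S`. -/
theorem card_meetingEvenly_le {n k : ℕ} (hk : 1 ≤ k) (hkn : 4 * k ≤ n) (S : Finset (Fin n))
    (hS : Odd k ∨ 2 * S.card ≤ n) :
    ((meetingEvenly k S).card : ℝ) ≤ (1 - 1 / 4 ^ k * (S.card / n)) * n.choose k := by
  have hn : (0 : ℝ) < n := by exact_mod_cast (by omega : 0 < n)
  have hSn : (S.card : ℝ) ≤ n := by exact_mod_cast (by simpa using Finset.card_le_univ S)
  by_cases hs : 2 * S.card ≤ n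
  · have h1 := card_meetingEvenly_add_le hk S
    have h1' : ((meetingEvenly k S).card : ℝ) + S.card * (n - S.card).choose (k - 1)
        ≤ n.choose k := by exact_mod_cast h1
    have h2 : ((n - 1).choose (k - 1) : ℝ) ≤ 4 ^ (k - 1) * (n - S.card).choose (k - 1) :=
      choose_le_four_pow_mul_choose (by omega)
    have h3 : (n.choose k : ℝ) * k = n * (n - 1).choose (k - 1) := by
      have := Nat.add_one_mul_choose_eq (n - 1) (k - 1)
      rw [Nat.sub_add_cancel hk, Nat.sub_add_cancel (by omega)] at this
      exact_mod_cast this.symm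
    have h4 : 1 / 4 ^ k * ((S.card : ℝ) / n) * n.choose k
        ≤ S.card * (n - S.card).choose (k - 1) := by
      have hk1 : (1 : ℝ) ≤ k := by exact_mod_cast hk
      have e : (4 : ℝ) ^ k = 4 * 4 ^ (k - 1) := by
        rw [← pow_succ', Nat.sub_add_cancel hk]
      calc 1 / 4 ^ k * ((S.card : ℝ) / n) * n.choose k
          ≤ 1 / 4 ^ k * ((S.card : ℝ) / n) * (n.choose k * k) := by
            gcongr
            exact le_mul_of_one_le_right (by positivity) hk1
        _ = S.card * (1 / 4 ^ k * (n - 1).choose (k - 1)) := by rw [h3]; field_simp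
        _ ≤ S.card * (1 / 4 ^ k * (4 ^ (k - 1) * (n - S.card).choose (k - 1))) := by gcongr
        _ = S.card * (1 / 4 * (n - S.card).choose (k - 1)) := by rw [e]; field_simp
        _ ≤ _ := by
            gcongr
            have : (0 : ℝ) ≤ (n - S.card).choose (k - 1) := by positivity
            linarith
    linarith
  · have hodd := hS.resolve_right hs
    have h1 : ((meetingEvenly k S).card : ℝ) + S.card.choose k ≤ n.choose k := by
      exact_mod_cast card_meetingEvenly_add_le_of_odd hodd S
    have h2 : (n.choose k : ℝ) ≤ 4 ^ k * S.card.choose k :=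
      choose_le_four_pow_mul_choose (by omega)
    have h4 : 1 / 4 ^ k * ((S.card : ℝ) / n) * n.choose k ≤ S.card.choose k := by
      calc 1 / 4 ^ k * ((S.card : ℝ) / n) * n.choose k
          ≤ 1 / 4 ^ k * 1 * (4 ^ k * S.card.choose k) := by
            gcongr
            exact div_le_one_of_le₀ hSn hn.le
        _ = _ := by field_simp
    linarith

/-! ### Rows and left kernel vectors after a given number of columns -/

/-- Row `i` is zero in the matrix formed by the first `m` columns. -/
def ZeroRow {n k : ℕ} (σ : ColumnOrder n k) (m : ℕ) (i : Fin n) : Prop :=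
  ∀ j : Fin (n.choose k), (j : ℕ) < m → i ∉ colSupp (σ j)

/-- The indicator vector of `S` is in the left kernel of the matrix formed by the first `m`
columns. -/
def KernelSet {n k : ℕ} (σ : ColumnOrder n k) (m : ℕ) (S : Finset (Fin n)) : Prop :=
  ∀ j : Fin (n.choose k), (j : ℕ) < m → Even (colSupp (σ j) ∩ S).card

section Events

variable {n k : ℕ}

theorem nonempty_columnOrder (n k : ℕ) : Nonempty (Fin (n.choose k) ≃ Omega n k) :=
  instNonemptyColumnOrder n k

/-- The first `m` positions in an ordering of the columns. -/
def firstPositions (M m : ℕ) : Finset (Fin M) := Finset.univ.filter fun j => (j : ℕ) < m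

theorem card_firstPositions {M m : ℕ} (h : m ≤ M) : (firstPositions M m).card = m := by
  have : (firstPositions M m).map Fin.valEmbedding = Finset.range m := by
    ext x
    simp only [firstPositions, Finset.mem_map, Finset.mem_filter, Finset.mem_univ, true_and,
      Fin.valEmbedding_apply, Finset.mem_range]
    constructor
    · rintro ⟨j, hj, rfl⟩; exact hj
    · intro hx; exact ⟨⟨x, hx.trans_le h⟩, hx, rfl⟩
  rw [← Finset.card_map, this, Finset.card_range]

theorem mem_avoiding_singleton (v : Omega n k) (i : Fin n) :
    v ∈ avoiding k {i} ↔ i ∉ colSupp v := by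
  simp [avoiding]

theorem mem_avoiding_pair (v : Omega n k) (i j : Fin n) :
    v ∈ avoiding k {i, j} ↔ i ∉ colSupp v ∧ j ∉ colSupp v := by
  simp [avoiding]

theorem zeroRow_iff (σ : ColumnOrder n k) (m : ℕ) (i : Fin n) :
    ZeroRow σ m i ↔ ∀ j ∈ firstPositions (n.choose k) m, σ j ∈ avoiding k {i} := by
  simp only [ZeroRow, firstPositions, Finset.mem_filter, Finset.mem_univ, true_and,
    mem_avoiding_singleton]

theorem zeroRow_and_iff (σ : ColumnOrder n k) (m : ℕ) (i j : Fin n) :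
    ZeroRow σ m i ∧ ZeroRow σ m j
      ↔ ∀ q ∈ firstPositions (n.choose k) m, σ q ∈ avoiding k {i, j} := by
  simp only [ZeroRow, firstPositions, Finset.mem_filter, Finset.mem_univ, true_and,
    mem_avoiding_pair]
  exact ⟨fun h q hq => ⟨h.1 q hq, h.2 q hq⟩,
    fun h => ⟨fun q hq => (h q hq).1, fun q hq => (h q hq).2⟩⟩

theorem kernelSet_iff (σ : ColumnOrder n k) (m : ℕ) (S : Finset (Fin n)) :
    KernelSet σ m S ↔ ∀ j ∈ firstPositions (n.choose k) m, σ j ∈ meetingEvenly k S := by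
  simp only [KernelSet, firstPositions, meetingEvenly, Finset.mem_filter, Finset.mem_univ, true_and]

theorem prob_avoiding_le {m : ℕ} (hkn : k ≤ n) (hn : 0 < n) (hm : m ≤ n.choose k)
    (S : Finset (Fin n)) :
    prob (fun σ : ColumnOrder n k =>
        ∀ j ∈ firstPositions (n.choose k) m, σ j ∈ avoiding k S)
      ≤ Real.exp (-(k * S.card * m / n)) := by
  have h := prob_forall_mem_le (firstPositions (n.choose k) m) (avoiding k S)
    (nonempty_columnOrder n k)
  rw [card_firstPositions hm, Fintype.card_fin] at h
  have hM : (0 : ℝ) < n.choose k := by exact_mod_cast Nat.choose_pos hkn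
  refine h.trans ?_
  calc (((avoiding k S).card : ℝ) / n.choose k) ^ m ≤ (Real.exp (-(k * S.card / n))) ^ m := by
        gcongr
        rw [div_le_iff₀ hM]
        exact card_avoiding_le_mul k hn S
    _ = _ := by rw [← Real.exp_nat_mul]; congr 1; ring

theorem prob_zeroRow_le {m : ℕ} (hkn : k ≤ n) (hm : m ≤ n.choose k) (i : Fin n) :
    prob (fun σ : ColumnOrder n k => ZeroRow σ m i) ≤ Real.exp (-(k * m / n)) := by
  rw [prob_congr fun σ => zeroRow_iff σ m i]
  have := prob_avoiding_le hkn i.pos hm {i}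
  simpa using this

theorem prob_exists_zeroRow_le {m : ℕ} (hkn : k ≤ n) (hm : m ≤ n.choose k) :
    prob (fun σ : ColumnOrder n k => ∃ i, ZeroRow σ m i) ≤ n * Real.exp (-(k * m / n)) := by
  have h := prob_exists_le (Finset.univ : Finset (Fin n))
    (fun i (σ : ColumnOrder n k) => ZeroRow σ m i)
  simp only [Finset.mem_univ, true_and] at h
  refine h.trans ?_
  calc _ ≤ ∑ _i : Fin n, Real.exp (-(k * m / n)) :=
        Finset.sum_le_sum fun i _ => prob_zeroRow_le hkn hm i
    _ = _ := by simp

/-- The probability that the column in position `p` meets two given rows that were zero until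
then. -/
theorem prob_zeroRows_and_pair_le {m : ℕ} (hk : 2 ≤ k) (hkn : k ≤ n) (hm : 2 * m ≤ n.choose k)
    {i j : Fin n} (hij : i ≠ j) {p : Fin (n.choose k)} (hp : m ≤ (p : ℕ)) :
    prob (fun σ : ColumnOrder n k =>
        (ZeroRow σ m i ∧ ZeroRow σ m j) ∧ i ∈ colSupp (σ p) ∧ j ∈ colSupp (σ p))
      ≤ 2 * (k : ℝ) ^ 2 / n ^ 2 * Real.exp (-(2 * k * m / n)) := by
  classical
  have hM0 : (0 : ℝ) < n.choose k := by exact_mod_cast Nat.choose_pos hkn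
  have hcard : ({i, j} : Finset (Fin n)).card = 2 := Finset.card_pair hij
  have hpn : p ∉ firstPositions (n.choose k) m := by simp [firstPositions, hp]
  have h := card_compl_mul_prob_le (firstPositions (n.choose k) m) (avoiding k {i, j})
    (Finset.univ.filter fun v : Omega n k => {i, j} ⊆ colSupp v) hpn
  have ha := prob_avoiding_le (m := m) hkn i.pos (by omega) {i, j}
  have hc := card_superset_le_mul hk hkn hcard
  rw [Finset.card_compl, card_firstPositions (by omega), Fintype.card_fin] at h
  have hMm : (n.choose k : ℝ) / 2 ≤ (n.choose k - m : ℕ) := by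
    rw [Nat.cast_sub (by omega)]
    have : (2 * m : ℝ) ≤ n.choose k := by exact_mod_cast hm
    linarith
  rw [prob_congr (q := fun σ : ColumnOrder n k => (∀ q ∈ firstPositions (n.choose k) m,
      σ q ∈ avoiding k {i, j}) ∧ σ p ∈ Finset.univ.filter fun v : Omega n k => {i, j} ⊆ colSupp v)]
  swap
  · intro σ
    rw [zeroRow_and_iff]
    simp [Finset.insert_subset_iff]
  set Q := prob (fun σ : ColumnOrder n k => (∀ q ∈ firstPositions (n.choose k) m,
      σ q ∈ avoiding k {i, j}) ∧ σ p ∈ Finset.univ.filter fun v : Omega n k => {i, j} ⊆ colSupp v)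
  have hQ0 : 0 ≤ Q := prob_nonneg _
  refine le_of_mul_le_mul_left ?_ (half_pos hM0)
  calc (n.choose k : ℝ) / 2 * Q ≤ (n.choose k - m : ℕ) * Q := by gcongr
    _ ≤ _ := h
    _ ≤ ((k : ℝ) ^ 2 / n ^ 2 * n.choose k)
          * Real.exp (-(k * ({i, j} : Finset (Fin n)).card * m / n)) := by
        gcongr
        exact prob_nonneg _
    _ = _ := by
        rw [hcard]; push_cast
        rw [mul_comm (k : ℝ) 2]; ring

/-- The probability that some column in a position from `m` to `m'` meets two rows that are zero
after `m` columns. -/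
theorem prob_exists_pair_le {m m' : ℕ} (hk : 2 ≤ k) (hkn : k ≤ n) (hm : 2 * m ≤ n.choose k)
    (hm' : m' ≤ n.choose k) :
    prob (fun σ : ColumnOrder n k => ∃ i j : Fin n, i ≠ j ∧ ∃ p : Fin (n.choose k),
        m ≤ (p : ℕ) ∧ (p : ℕ) < m' ∧
        (ZeroRow σ m i ∧ ZeroRow σ m j) ∧ i ∈ colSupp (σ p) ∧ j ∈ colSupp (σ p))
      ≤ m' * (2 * (k : ℝ) ^ 2 * Real.exp (-(2 * k * m / n))) := by
  classical
  let E : Fin (n.choose k) × (Fin n × Fin n) → ColumnOrder n k → Prop := fun x σ =>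
    (ZeroRow σ m x.2.1 ∧ ZeroRow σ m x.2.2) ∧ x.2.1 ∈ colSupp (σ x.1) ∧ x.2.2 ∈ colSupp (σ x.1)
  let s : Finset (Fin (n.choose k) × (Fin n × Fin n)) :=
    ((firstPositions (n.choose k) m').filter fun p : Fin (n.choose k) => m ≤ (p : ℕ)) ×ˢ
      (Finset.univ.filter fun x : Fin n × Fin n => x.1 ≠ x.2)
  have h1 := prob_exists_le s E
  have hn : 0 < (n : ℝ) := by exact_mod_cast (by omega : 0 < n)
  have hs : (s.card : ℝ) ≤ m' * n ^ 2 := by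
    have : s.card ≤ m' * (n * n) := by
      rw [Finset.card_product]
      refine Nat.mul_le_mul ?_ ?_
      · exact (Finset.card_filter_le _ _).trans (card_firstPositions hm').le
      · refine (Finset.card_filter_le _ _).trans ?_
        simp
    calc (s.card : ℝ) ≤ ((m' * (n * n) : ℕ) : ℝ) := by exact_mod_cast this
      _ = _ := by push_cast; ring
  calc _ ≤ prob (fun σ => ∃ x ∈ s, E x σ) := by
        refine prob_mono ?_
        rintro σ ⟨i, j, hij, p, hp, hp', h⟩
        refine ⟨(p, (i, j)), ?_, h⟩
        simp [s, firstPositions, hp, hp', hij]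
    _ ≤ _ := h1
    _ ≤ ∑ x ∈ s, 2 * (k : ℝ) ^ 2 / n ^ 2 * Real.exp (-(2 * k * m / n)) := by
        refine Finset.sum_le_sum ?_
        rintro ⟨p, i, j⟩ hx
        simp only [s, Finset.mem_product, Finset.mem_filter, Finset.mem_univ, true_and] at hx
        exact prob_zeroRows_and_pair_le hk hkn hm hx.2 hx.1.2
    _ = s.card * (2 * (k : ℝ) ^ 2 / n ^ 2 * Real.exp (-(2 * k * m / n))) := by
        rw [Finset.sum_const, nsmul_eq_mul]
    _ ≤ (m' * n ^ 2) * (2 * (k : ℝ) ^ 2 / n ^ 2 * Real.exp (-(2 * k * m / n))) := by gcongr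
    _ = _ := by field_simp

theorem prob_kernelSet_le_pow {m : ℕ} (hkn : k ≤ n) (hm : m ≤ n.choose k) (S : Finset (Fin n))
    {x : ℝ} (hx : ((meetingEvenly k S).card : ℝ) ≤ x * n.choose k) :
    prob (fun σ : ColumnOrder n k => KernelSet σ m S) ≤ x ^ m := by
  rw [prob_congr fun σ => kernelSet_iff σ m S]
  have h := prob_forall_mem_le (firstPositions (n.choose k) m) (meetingEvenly k S)
    (nonempty_columnOrder n k)
  rw [card_firstPositions hm, Fintype.card_fin] at h
  have hM : (0 : ℝ) < n.choose k := by exact_mod_cast Nat.choose_pos hkn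
  refine h.trans ?_
  gcongr
  rwa [div_le_iff₀ hM]

/-- The probability that `S` is a kernel set that contains a nonzero row: some column has to
meet `S` twice, which costs a factor of order `m * (|S| / n) ^ 2`. -/
theorem prob_kernelSet_and_not_zeroRow_le {m : ℕ} (hk : 2 ≤ k) (hkn : k ≤ n)
    (hm : 2 * m ≤ n.choose k) (S : Finset (Fin n))
    {x : ℝ} (hx : ((meetingEvenly k S).card : ℝ) ≤ x * n.choose k) :
    prob (fun σ : ColumnOrder n k => KernelSet σ m S ∧ ∃ i ∈ S, ¬ ZeroRow σ m i)
      ≤ m * (2 * ((k : ℝ) ^ 2 * S.card ^ 2 / n ^ 2)) * x ^ (m - 1) := by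
  classical
  set M := n.choose k with hM
  have hM0 : (0 : ℝ) < M := by exact_mod_cast Nat.choose_pos hkn
  let T := firstPositions M m
  have hT : T.card = m := card_firstPositions (by omega)
  let E : Fin M → ColumnOrder n k → Prop := fun p σ =>
    (∀ q ∈ T.erase p, σ q ∈ meetingEvenly k S) ∧ σ p ∈ meetingTwice k S
  have hE : ∀ p ∈ T, prob (E p) ≤ 2 * ((k : ℝ) ^ 2 * S.card ^ 2 / n ^ 2) * x ^ (m - 1) := by
    intro p hp
    have hc : (T.erase p).card = m - 1 := by rw [Finset.card_erase_of_mem hp, hT]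
    have h := card_compl_mul_prob_le (T.erase p) (meetingEvenly k S) (meetingTwice k S)
      (Finset.notMem_erase p T)
    have h1 := prob_forall_mem_le (T.erase p) (meetingEvenly k S) (nonempty_columnOrder n k)
    have h2 := card_meetingTwice_le_mul hk hkn S
    rw [hc, Fintype.card_fin] at h1
    rw [Finset.card_compl, hc, Fintype.card_fin] at h
    have h3 : (((meetingEvenly k S).card : ℝ) / M) ^ (m - 1) ≤ x ^ (m - 1) := by
      gcongr
      rwa [div_le_iff₀ hM0]
    have hMm : (M : ℝ) / 2 ≤ (M - (m - 1) : ℕ) := by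
      have h : M ≤ 2 * (M - (m - 1)) := by omega
      have : (M : ℝ) ≤ 2 * (M - (m - 1) : ℕ) := by exact_mod_cast h
      linarith
    have hQ0 : 0 ≤ prob (E p) := prob_nonneg _
    refine le_of_mul_le_mul_left ?_ (half_pos hM0)
    calc (M : ℝ) / 2 * prob (E p) ≤ (M - (m - 1) : ℕ) * prob (E p) := by gcongr
      _ ≤ _ := h
      _ ≤ ((k : ℝ) ^ 2 * S.card ^ 2 / n ^ 2 * M) * x ^ (m - 1) := by
        gcongr
        · exact prob_nonneg _
        · exact h1.trans h3
      _ = _ := by ring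
  calc _ ≤ prob (fun σ => ∃ p ∈ T, E p σ) := by
        refine prob_mono ?_
        rintro σ ⟨hker, i, hi, hz⟩
        rw [kernelSet_iff] at hker
        simp only [ZeroRow, not_forall, not_not] at hz
        obtain ⟨p, hp, hip⟩ := hz
        have hpT : p ∈ T := by simpa [T, firstPositions] using hp
        refine ⟨p, hpT, fun q hq => hker q (Finset.mem_of_mem_erase hq), ?_⟩
        have he := hker p hpT
        simp only [meetingEvenly, meetingTwice, Finset.mem_filter, Finset.mem_univ,
          true_and] at he ⊢
        have hpos : 0 < (colSupp (σ p) ∩ S).card :=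
          Finset.card_pos.2 ⟨i, Finset.mem_inter.2 ⟨hip, hi⟩⟩
        obtain ⟨r, hr⟩ := he
        omega
    _ ≤ _ := prob_exists_le T E
    _ ≤ ∑ p ∈ T, 2 * ((k : ℝ) ^ 2 * S.card ^ 2 / n ^ 2) * x ^ (m - 1) := Finset.sum_le_sum hE
    _ = _ := by rw [Finset.sum_const, nsmul_eq_mul, hT]; ring

/-- The exact probability that a given row is zero after `m` columns. -/
noncomputable def zeroRowProb (n k m : ℕ) : ℝ :=
  ∏ j ∈ Finset.range m, (((n - 1).choose k : ℝ) - j) / (n.choose k - j)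

theorem prob_zeroRow_eq {m : ℕ} (hm : m ≤ n.choose k) (i : Fin n) :
    prob (fun σ : ColumnOrder n k => ZeroRow σ m i) = zeroRowProb n k m := by
  rw [prob_congr fun σ => zeroRow_iff σ m i, prob_forall_mem_eq _ _ (nonempty_columnOrder n k),
    card_firstPositions hm, card_avoiding, Fintype.card_fin, Finset.card_singleton, zeroRowProb]

theorem choose_sub_two_mul_choose_le (n k : ℕ) :
    (n.choose k : ℝ) * (n + 2).choose k ≤ (n + 1).choose k ^ 2 := by
  rcases Nat.lt_or_ge (n + 1) k with h | h
  · rw [Nat.choose_eq_zero_of_lt (by omega : n < k), Nat.cast_zero, zero_mul]; positivity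
  have e1 : ((n : ℝ) + 1) * n.choose k = (n + 1).choose k * (n + 1 - k) := by
    have := Nat.choose_mul_succ_eq n k
    rw [← Nat.cast_inj (R := ℝ)] at this
    push_cast [Nat.cast_sub h] at this
    linarith
  have e2 : ((n : ℝ) + 2) * (n + 1).choose k = (n + 2).choose k * (n + 2 - k) := by
    have := Nat.choose_mul_succ_eq (n + 1) k
    rw [← Nat.cast_inj (R := ℝ)] at this
    push_cast [Nat.cast_sub (h.trans (Nat.le_succ _))] at this
    linarith
  have hk : (k : ℝ) ≤ n + 1 := by exact_mod_cast h
  set a : ℝ := (n.choose k : ℝ)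
  set b : ℝ := ((n + 1).choose k : ℝ)
  set c : ℝ := ((n + 2).choose k : ℝ)
  have hb : 0 ≤ b := by positivity
  have hpos : (0 : ℝ) < (n + 1) * (n + 2 - k) := by
    have : (0 : ℝ) < n + 2 - k := by linarith
    positivity
  refine le_of_mul_le_mul_left ?_ hpos
  calc ((n : ℝ) + 1) * (n + 2 - k) * (a * c) = ((n + 1) * a) * (c * (n + 2 - k)) := by ring
    _ = b ^ 2 * ((n + 1 - k) * (n + 2)) := by rw [e1, ← e2]; ring
    _ ≤ b ^ 2 * ((n + 1) * (n + 2 - k)) := by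
        gcongr ?_ * ?_
        have : (0 : ℝ) ≤ k := by positivity
        nlinarith
    _ = _ := by ring

theorem two_mul_choose_le (n k : ℕ) :
    2 * ((n + 1).choose k : ℝ) ≤ n.choose k + (n + 2).choose k := by
  rcases k with _ | k
  · norm_num
  · have h1 := Nat.choose_succ_succ' n k
    have h2 : (n + 2).choose (k + 1) = _ := Nat.choose_succ_succ' (n + 1) k
    have h3 : n.choose k ≤ (n + 1).choose k := Nat.choose_le_choose k (Nat.le_succ n)
    have : 2 * (n + 1).choose (k + 1) ≤ n.choose (k + 1) + (n + 2).choose (k + 1) := by omega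
    exact_mod_cast this

/-- The events that given rows are zero are pairwise nonpositively correlated. -/
theorem prob_zeroRow_and_le {m : ℕ} (hm : m ≤ n.choose k) {i j : Fin n} (hij : i ≠ j) :
    prob (fun σ : ColumnOrder n k => ZeroRow σ m i ∧ ZeroRow σ m j) ≤ zeroRowProb n k m ^ 2 := by
  rw [prob_congr fun σ => zeroRow_and_iff σ m i j,
    prob_forall_mem_eq _ _ (nonempty_columnOrder n k), card_firstPositions hm, card_avoiding,
    Fintype.card_fin, Finset.card_pair hij, zeroRowProb]
  obtain ⟨r, rfl⟩ : ∃ r, n = r + 2 := by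
    have h1 := i.2
    have h2 := j.2
    have h3 : (i : ℕ) ≠ j := fun h => hij (Fin.ext h)
    exact ⟨n - 2, by omega⟩
  have hA := choose_sub_two_mul_choose_le r k
  have hB := two_mul_choose_le r k
  simp only [Nat.add_sub_cancel, Nat.add_succ_sub_one]
  induction m with
  | zero => simp
  | succ m ih =>
    have hpos : (0 : ℝ) < (r + 2).choose k - m := by
      rw [sub_pos]; exact_mod_cast hm
    rw [Finset.prod_range_succ, Finset.prod_range_succ, mul_pow]
    set P := ∏ x ∈ Finset.range m, (((r + 1).choose k : ℝ) - x) / ((r + 2).choose k - x)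
    by_cases hneg : (r.choose k : ℝ) < m
    · -- the last factor on the left is negative, and the product of the others is a probability
      have hQ : 0 ≤ ∏ x ∈ Finset.range m, ((r.choose k : ℝ) - x) / ((r + 2).choose k - x) := by
        have := prob_forall_mem_eq (firstPositions ((r + 2).choose k) m) (avoiding k {i, j})
          (nonempty_columnOrder (r + 2) k)
        rw [card_firstPositions (by omega), card_avoiding, Fintype.card_fin,
          Finset.card_pair hij, Nat.add_sub_cancel] at this
        rw [← this]
        exact prob_nonneg _
      refine (mul_nonpos_of_nonneg_of_nonpos hQ ?_).trans (by positivity)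
      exact div_nonpos_of_nonpos_of_nonneg (by linarith) hpos.le
    · have hge : 0 ≤ (r.choose k : ℝ) - m := by linarith
      refine mul_le_mul (ih (by omega)) ?_ (by positivity) (by positivity)
      rw [div_pow, div_le_div_iff₀ hpos (by positivity)]
      have : ((r.choose k : ℝ) - m) * ((r + 2).choose k - m) ≤ ((r + 1).choose k - m) ^ 2 := by
        have hm0 : (0 : ℝ) ≤ m := by positivity
        nlinarith
      calc ((r.choose k : ℝ) - m) * ((r + 2).choose k - m) ^ 2
          = (((r.choose k : ℝ) - m) * ((r + 2).choose k - m)) * ((r + 2).choose k - m) := by ring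
        _ ≤ _ := by gcongr

theorem prob_forall_not_zeroRow_le {m : ℕ} (hm : m ≤ n.choose k) (h : 0 < n * zeroRowProb n k m) :
    prob (fun σ : ColumnOrder n k => ∀ i, ¬ ZeroRow σ m i) ≤ 1 / (n * zeroRowProb n k m) := by
  have := prob_forall_not_le (fun (i : Fin n) (σ : ColumnOrder n k) => ZeroRow σ m i)
    (prob_zeroRow_eq hm) (fun i j hij => prob_zeroRow_and_le hm hij)
  rw [Fintype.card_fin] at this
  exact this h

end Events

/-! ### The first moment of the number of kernel sets -/

section FirstMoment

variable {n k : ℕ}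

theorem exp_neg_add_pow_le {a b K : ℝ} (t : ℕ) (hb : 0 ≤ b) (ha : a ≤ K) :
    (Real.exp (-a) + b) ^ t ≤ Real.exp (-(t * a) + Real.exp K * (t * b)) := by
  have h : Real.exp (-a) + b ≤ Real.exp (-a + Real.exp K * b) := by
    have h1 : b ≤ Real.exp (-a) * (Real.exp K * b) := by
      rw [← mul_assoc, ← Real.exp_add]
      exact le_mul_of_one_le_left hb (Real.one_le_exp (by linarith))
    calc Real.exp (-a) + b ≤ Real.exp (-a) * (Real.exp K * b + 1) := by linarith
      _ ≤ Real.exp (-a) * Real.exp (Real.exp K * b) := by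
          gcongr
          exact Real.add_one_le_exp _
      _ = _ := by rw [← Real.exp_add]
  calc (Real.exp (-a) + b) ^ t ≤ Real.exp (-a + Real.exp K * b) ^ t := by
        gcongr
    _ = _ := by rw [← Real.exp_nat_mul]; congr 1; ring

/-- The expected number of kernel sets of size `s` with a nonzero row, for small `s`. The factor
`n ^ s` from the choice of the set cancels against `exp (-L * s)`; the error term `(k * s / n) ^ 2`
in the probability of an even intersection contributes only a constant to the power `s`, because
`s * L ≤ n`. -/
theorem choose_mul_small_le {L W : ℝ} {m s : ℕ} (hn : Real.exp L = n) (hL : 1 ≤ L) (hW : 0 < W)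
    (hs : s * L ≤ n) (hm : (m : ℝ) ≤ n * L) (hlow : n * (L - Real.log W) ≤ k * (m - 1 : ℕ))
    (hup : (k : ℝ) * (m - 1 : ℕ) ≤ n * L) :
    (n.choose s : ℝ) * (m * (2 * ((k : ℝ) ^ 2 * s ^ 2 / n ^ 2))
        * (Real.exp (-(k * s / n)) + (k : ℝ) ^ 2 * s ^ 2 / n ^ 2) ^ (m - 1))
      ≤ (4 * W * Real.exp (k * Real.exp k)) ^ s / s.factorial * (2 * k ^ 2 * L / n) := by
  have hn0 : (0 : ℝ) < n := hn ▸ Real.exp_pos L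
  set t : ℝ := ((m - 1 : ℕ) : ℝ) with ht
  have hs0 : (0 : ℝ) ≤ s := by positivity
  have hsn : (s : ℝ) ≤ n := (le_mul_of_one_le_right hs0 hL).trans hs
  have h1 := exp_neg_add_pow_le (a := k * s / n) (b := (k : ℝ) ^ 2 * s ^ 2 / n ^ 2) (K := k) (m - 1)
    (by positivity) (by
      rw [div_le_iff₀ hn0]; gcongr)
  rw [← ht] at h1
  have h2 : s * (L - Real.log W) ≤ t * (k * s / n) := by
    calc s * (L - Real.log W) = s / n * (n * (L - Real.log W)) := by field_simp
      _ ≤ s / n * (k * t) := by gcongr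
      _ = _ := by ring
  have h3 : t * ((k : ℝ) ^ 2 * s ^ 2 / n ^ 2) ≤ k * s := by
    calc t * ((k : ℝ) ^ 2 * s ^ 2 / n ^ 2) = (k * t) * (k * s ^ 2 / n ^ 2) := by ring
      _ ≤ (n * L) * (k * s ^ 2 / n ^ 2) := by gcongr
      _ = k * s * (s * L) / n := by field_simp
      _ ≤ k * s * n / n := by gcongr
      _ = _ := by field_simp
  have h4 : (Real.exp (-(k * s / n)) + (k : ℝ) ^ 2 * s ^ 2 / n ^ 2) ^ (m - 1)
      ≤ (W * Real.exp (k * Real.exp k)) ^ s / n ^ s := by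
    refine h1.trans ?_
    calc _ ≤ Real.exp (-(s * (L - Real.log W)) + Real.exp k * (k * s)) := by gcongr
      _ = Real.exp (s * (Real.log W + k * Real.exp k) - s * L) := by congr 1; ring
      _ = _ := by
        rw [Real.exp_sub, Real.exp_nat_mul, Real.exp_nat_mul, Real.exp_add, Real.exp_log hW, hn]
  have h5 : (n.choose s : ℝ) ≤ n ^ s / s.factorial := Nat.choose_le_pow_div s n
  have h6 : (s : ℝ) ^ 2 ≤ 4 ^ s := by
    have : (s : ℝ) ≤ 2 ^ s := by exact_mod_cast (Nat.lt_two_pow_self (n := s)).le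
    calc (s : ℝ) ^ 2 ≤ (2 ^ s) ^ 2 := by gcongr
      _ = 4 ^ s := by rw [← pow_mul, mul_comm, pow_mul]; norm_num
  have hD : 0 < W * Real.exp (k * Real.exp k) := by positivity
  calc _ ≤ (n : ℝ) ^ s / s.factorial * ((n * L) * (2 * ((k : ℝ) ^ 2 * 4 ^ s / n ^ 2))
        * ((W * Real.exp (k * Real.exp k)) ^ s / n ^ s)) := by gcongr
    _ = _ := by
        rw [mul_assoc 4 W, mul_pow 4]
        field_simp

/-- The expected number of kernel sets of size `s`, for large `s`. -/
theorem choose_mul_large_le {L l c : ℝ} {m s : ℕ} (hn : 0 < n) (hk : 0 < k)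
    (hs : n < s * L) (hc0 : 0 ≤ c) (hcs : 0 ≤ 1 - c * (s / n)) (hlow : n * l ≤ k * m) :
    (n.choose s : ℝ) * (1 - c * (s / n)) ^ m ≤ (Real.exp 1 * L * Real.exp (-(c * l / k))) ^ s := by
  have hn0 : (0 : ℝ) < n := by exact_mod_cast hn
  have hk0 : (0 : ℝ) < k := by exact_mod_cast hk
  have hs0 : (0 : ℝ) < s := by
    rcases Nat.eq_zero_or_pos s with rfl | h
    · simp at hs; linarith
    · exact_mod_cast h
  have hL : 0 < L := by
    by_contra h
    nlinarith
  have h1 : (n.choose s : ℝ) ≤ (Real.exp 1 * L) ^ s := by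
    have h5 : (n.choose s : ℝ) ≤ n ^ s / s.factorial := Nat.choose_le_pow_div s n
    have h6 := Real.pow_div_factorial_le_exp (s : ℝ) hs0.le s
    -- `s ^ s / s! ≤ exp s` replaces Stirling's formula
    have h7 : Real.exp s = Real.exp 1 ^ s := by rw [← Real.exp_nat_mul, mul_one]
    calc (n.choose s : ℝ) ≤ n ^ s / s.factorial := h5
      _ ≤ (s * L) ^ s / s.factorial := by gcongr
      _ = L ^ s * (s ^ s / s.factorial) := by rw [mul_pow]; ring
      _ ≤ L ^ s * Real.exp 1 ^ s := by rw [← h7]; gcongr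
      _ = _ := by rw [mul_pow]; ring
  have h2 : (1 - c * (s / n)) ^ m ≤ Real.exp (-(c * l / k)) ^ s := by
    have : 1 - c * (s / n) ≤ Real.exp (-(c * (s / n))) := by
      have := Real.add_one_le_exp (-(c * (s / n : ℝ)))
      linarith
    calc (1 - c * (s / n)) ^ m ≤ Real.exp (-(c * (s / n))) ^ m := by gcongr
      _ = Real.exp (-(c * s / (n * k) * (k * m))) := by
          rw [← Real.exp_nat_mul]; congr 1; field_simp
      _ ≤ Real.exp (-(c * s / (n * k) * (n * l))) := by gcongr
      _ = _ := by rw [← Real.exp_nat_mul]; congr 1; field_simp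
  calc _ ≤ (Real.exp 1 * L) ^ s * Real.exp (-(c * l / k)) ^ s := by gcongr
    _ = _ := by rw [← mul_pow]

/-- After `m` columns, with `m` close to `(n / k) * log n` from below, it is unlikely that there is
a kernel set with a nonzero row. For even `k`, kernel sets come in complementary pairs, and only one
set of each pair is considered. -/
theorem prob_exists_kernelSet_le {L W : ℝ} {m : ℕ} (hk : 2 ≤ k) (hkn : 4 * k ≤ n)
    (hM : 2 * m ≤ n.choose k) (hn : Real.exp L = n) (hL : 1 ≤ L) (hW : 0 < W)
    (hm : (m : ℝ) ≤ n * L) (hlow : n * (L - Real.log W) ≤ k * (m - 1 : ℕ))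
    (hup : (k : ℝ) * (m - 1 : ℕ) ≤ n * L)
    (hy : Real.exp 1 * L * Real.exp (-(1 / 4 ^ k * (L - Real.log W) / k)) ≤ 1 / 2) :
    prob (fun σ : ColumnOrder n k => ∃ S : Finset (Fin n), (Odd k ∨ 2 * S.card ≤ n) ∧
        KernelSet σ m S ∧ ∃ i ∈ S, ¬ ZeroRow σ m i)
      ≤ Real.exp (4 * W * Real.exp (k * Real.exp k)) * (2 * k ^ 2 * L / n)
        + 4 * (Real.exp 1 * L * Real.exp (-(1 / 4 ^ k * (L - Real.log W) / k))) := by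
  classical
  have hn0 : (0 : ℝ) < n := hn ▸ Real.exp_pos L
  set y := Real.exp 1 * L * Real.exp (-(1 / 4 ^ k * (L - Real.log W) / k)) with hydef
  set A := 4 * W * Real.exp (k * Real.exp k) with hA
  set δ := 2 * (k : ℝ) ^ 2 * L / n with hδ
  have hA0 : 0 ≤ A := by positivity
  have hδ0 : 0 ≤ δ := by positivity
  have hy0 : 0 ≤ y := by positivity
  let b : ℕ → ℝ := fun s => if s * L ≤ n then
      m * (2 * ((k : ℝ) ^ 2 * s ^ 2 / n ^ 2))
        * (Real.exp (-(k * s / n)) + (k : ℝ) ^ 2 * s ^ 2 / n ^ 2) ^ (m - 1)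
    else (1 - 1 / 4 ^ k * (s / n)) ^ m
  have hc (s : ℕ) (hs : s ≤ n) : 0 ≤ 1 - 1 / 4 ^ k * ((s : ℝ) / n) := by
    have h1 : (1 : ℝ) / 4 ^ k ≤ 1 := by
      apply div_le_one_of_le₀ _ (by positivity)
      exact one_le_pow₀ (by norm_num)
    have h2 : (s : ℝ) / n ≤ 1 := div_le_one_of_le₀ (by exact_mod_cast hs) hn0.le
    have h3 : (0 : ℝ) ≤ s / n := by positivity
    nlinarith
  have hb0 (s : ℕ) (hs : s ≤ n) : 0 ≤ b s := by
    simp only [b]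
    split_ifs
    · positivity
    · exact pow_nonneg (hc s hs) m
  have hcard (S : Finset (Fin n)) : S.card ≤ n := by simpa using Finset.card_le_univ S
  have hb (S : Finset (Fin n)) : prob (fun σ : ColumnOrder n k => (Odd k ∨ 2 * S.card ≤ n) ∧
      KernelSet σ m S ∧ ∃ i ∈ S, ¬ ZeroRow σ m i) ≤ b S.card := by
    by_cases hS : Odd k ∨ 2 * S.card ≤ n
    · rw [prob_congr fun σ => and_iff_right hS]
      simp only [b]
      split_ifs
      · exact prob_kernelSet_and_not_zeroRow_le hk (by omega) hM S
          (card_meetingEvenly_le_of_small hk (by omega) S)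
      · exact (prob_mono fun σ h => h.1).trans (prob_kernelSet_le_pow (by omega) (by omega) S
          (card_meetingEvenly_le (by omega) hkn S hS))
    · -- the event is empty
      rw [prob_congr (q := fun _ => False) fun σ => by simp [hS]]
      refine le_trans (le_of_eq ?_) (hb0 _ (hcard S))
      simp [prob]
  have hterm (s : ℕ) (hs : s ≤ n) :
      (n.choose s : ℝ) * b s ≤ A ^ s / s.factorial * δ + 2 * y * (1 / 2) ^ s := by
    simp only [b]
    split_ifs with h
    · refine (choose_mul_small_le hn hL hW h hm hlow hup).trans ?_
      have : 0 ≤ 2 * y * (1 / 2) ^ s := by positivity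
      linarith
    · have hs0 : s ≠ 0 := by
        rintro rfl
        simp at h
      obtain ⟨r, rfl⟩ : ∃ r, s = r + 1 := ⟨s - 1, by omega⟩
      have h1 := choose_mul_large_le (L := L) (l := L - Real.log W) (c := 1 / 4 ^ k) (m := m)
        (by omega : 0 < n) (by omega : 0 < k) (not_le.1 h) (by positivity) (hc _ hs)
        (hlow.trans (by gcongr; omega))
      -- one factor `y` is kept, since the sum has to tend to zero with `y`
      have h2 : y ^ (r + 1) ≤ 2 * y * (1 / 2) ^ (r + 1) := by
        calc y ^ (r + 1) = y * y ^ r := pow_succ' y r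
          _ ≤ y * (1 / 2) ^ r := by gcongr
          _ = _ := by rw [pow_succ]; ring
      have : 0 ≤ A ^ (r + 1) / ((r + 1).factorial : ℝ) * δ := by positivity
      calc _ ≤ _ := h1
        _ ≤ _ := h2
        _ ≤ _ := by linarith
  have hunion := prob_exists_le (Finset.univ : Finset (Finset (Fin n)))
    (fun S (σ : ColumnOrder n k) => (Odd k ∨ 2 * S.card ≤ n) ∧
      KernelSet σ m S ∧ ∃ i ∈ S, ¬ ZeroRow σ m i)
  simp only [Finset.mem_univ, true_and] at hunion
  calc _ ≤ _ := hunion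
    _ ≤ ∑ S : Finset (Fin n), b S.card := Finset.sum_le_sum fun S _ => hb S
    _ = ∑ s ∈ Finset.range (n + 1), (n.choose s : ℝ) * b s := by
        rw [← Finset.powerset_univ, Finset.sum_powerset_apply_card]
        simp
    _ ≤ ∑ s ∈ Finset.range (n + 1), (A ^ s / s.factorial * δ + 2 * y * (1 / 2) ^ s) :=
        Finset.sum_le_sum fun s hs => hterm s (by simpa [Nat.lt_succ_iff] using hs)
    _ = (∑ s ∈ Finset.range (n + 1), A ^ s / s.factorial) * δ
          + 2 * y * ∑ s ∈ Finset.range (n + 1), (1 / 2 : ℝ) ^ s := by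
        rw [Finset.sum_add_distrib, Finset.sum_mul, Finset.mul_sum]
    _ ≤ Real.exp A * δ + 2 * y * 2 := by
        gcongr
        · exact Real.sum_le_exp_of_nonneg hA0 _
        · exact sum_geometric_two_le _
    _ = _ := by ring

end FirstMoment

/-! ### The expected number of zero rows -/

theorem exp_neg_le_zeroRowProb {n k m : ℕ} (hn : 0 < n) (hkn : k + 1 < n)
    (hm : n * m ≤ n.choose k) :
    Real.exp (-(k * m / (n - k - 1))) ≤ zeroRowProb n k m := by
  have hn0 : (0 : ℝ) < n := by exact_mod_cast hn
  have hM0 : (0 : ℝ) < n.choose k := by exact_mod_cast Nat.choose_pos (by omega)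
  have hA : ((n - 1).choose k : ℝ) = n.choose k * (1 - k / n) := by
    have h := Nat.choose_mul_succ_eq (n - 1) k
    rw [Nat.sub_add_cancel hn] at h
    have h' : ((n - 1).choose k : ℝ) * n = n.choose k * (n - k) := by
      rw [← Nat.cast_sub (by omega)]; exact_mod_cast h
    field_simp
    linarith
  set M : ℝ := (n.choose k : ℝ) with hM
  have hd : (0 : ℝ) < n - k - 1 := by
    have : (k : ℝ) + 1 < n := by exact_mod_cast hkn
    linarith
  have hk0 : (0 : ℝ) ≤ k := by positivity
  have hmM : (n : ℝ) * m ≤ M := by rw [hM]; exact_mod_cast hm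
  have key (j : ℕ) (hj : j < m) :
      Real.exp (-(k / (n - k - 1))) ≤ (M * (1 - k / n) - j) / (M - j) := by
    have hjM : (n : ℝ) * j ≤ M := by
      have : (j : ℝ) ≤ m := by exact_mod_cast hj.le
      nlinarith
    have hn1 : (1 : ℝ) < n := by linarith
    have hpos : 0 < M - j := by
      have hj0 : (0 : ℝ) ≤ j := by positivity
      rcases hj0.eq_or_lt with h | h
      · rw [← h]; linarith
      · nlinarith
    rw [Real.exp_neg]
    have h1 : ((k : ℝ) / (n - k - 1) + 1)⁻¹ ≤ (M * (1 - k / n) - j) / (M - j) := by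
      have e : (k : ℝ) / (n - k - 1) + 1 = (n - 1) / (n - k - 1) := by field_simp; ring
      have e2 : M * (1 - k / n) - j = (M * (n - k) - n * j) / n := by field_simp
      rw [e, inv_div, e2, div_div, div_le_div_iff₀ (by linarith) (by positivity)]
      nlinarith [mul_nonneg hk0 (sub_nonneg.2 hjM)]
    refine le_trans ?_ h1
    gcongr
    exact Real.add_one_le_exp _
  calc Real.exp (-(k * m / (n - k - 1)))
      = ∏ j ∈ Finset.range m, Real.exp (-(k / (n - k - 1))) := by
        rw [Finset.prod_const, Finset.card_range, ← Real.exp_nat_mul]; congr 1; ring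
    _ ≤ ∏ j ∈ Finset.range m, (M * (1 - k / n) - j) / (M - j) :=
        Finset.prod_le_prod (fun _ _ => (Real.exp_pos _).le)
          fun j hj => key j (Finset.mem_range.1 hj)
    _ = zeroRowProb n k m := by rw [zeroRowProb, hA]

/-! ### Rank and left kernel -/

section LinearAlgebra

variable {n k : ℕ}

theorem firstColumns_row_ne_zero_iff (σ : ColumnOrder n k) (m : ℕ) (i : Fin n) :
    firstColumns σ m i ≠ 0 ↔ ¬ ZeroRow σ m i := by
  have hz : ∀ a : ZMod 2, a ≠ 0 ↔ a = 1 := by decide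
  simp only [ZeroRow, Function.ne_iff, firstColumns, Matrix.of_apply, Pi.zero_apply, hz, colSupp,
    Finset.mem_filter, Finset.mem_univ, true_and, not_forall, not_not, Subtype.exists, exists_prop]

theorem numNonzeroRows_eq_iff (σ : ColumnOrder n k) (m : ℕ) :
    numNonzeroRows (firstColumns σ m) = n ↔ ∀ i, ¬ ZeroRow σ m i := by
  have h := Set.eq_univ_iff_ncard {i : Fin n | firstColumns σ m i ≠ 0}
  rw [Nat.card_eq_fintype_card, Fintype.card_fin] at h
  rw [numNonzeroRows, ← h, Set.eq_univ_iff_forall]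
  simp only [Set.mem_ofPred_eq, firstColumns_row_ne_zero_iff]

/-- The left kernel of the matrix formed by the first `m` columns. -/
noncomputable def leftKernel (σ : ColumnOrder n k) (m : ℕ) : Submodule (ZMod 2) (Fin n → ZMod 2) :=
  LinearMap.ker (firstColumns σ m).transpose.mulVecLin

theorem mem_leftKernel_iff (σ : ColumnOrder n k) (m : ℕ) (x : Fin n → ZMod 2) :
    x ∈ leftKernel σ m ↔ KernelSet σ m (Finset.univ.filter fun i => x i = 1) := by
  have hz : ∀ a b : ZMod 2, a * b = if a = 1 ∧ b = 1 then 1 else 0 := by decide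
  rw [leftKernel, LinearMap.mem_ker, Matrix.mulVecLin_apply, funext_iff, KernelSet, Subtype.forall]
  refine forall₂_congr fun j hj => ?_
  rw [← ZMod.natCast_eq_zero_iff_even, colSupp, ← Finset.filter_and, Finset.natCast_card_filter]
  simp only [Matrix.mulVec, dotProduct, Matrix.transpose_apply, firstColumns, Matrix.of_apply, hz,
    Pi.zero_apply]

theorem rank_add_finrank_leftKernel (σ : ColumnOrder n k) (m : ℕ) :
    (firstColumns σ m).rank + Module.finrank (ZMod 2) (leftKernel σ m) = n := by
  have h := LinearMap.finrank_range_add_finrank_ker (firstColumns σ m).transpose.mulVecLin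
  rw [Module.finrank_fin_fun] at h
  rw [← Matrix.rank_transpose]
  exact h

theorem one_mem_leftKernel (hk : Even k) (σ : ColumnOrder n k) (m : ℕ) :
    (1 : Fin n → ZMod 2) ∈ leftKernel σ m := by
  rw [mem_leftKernel_iff]
  intro j _
  simpa [card_colSupp] using hk

theorem single_mem_leftKernel {σ : ColumnOrder n k} {m : ℕ} {i : Fin n} (h : ZeroRow σ m i) :
    Pi.single i 1 ∈ leftKernel σ m := by
  rw [mem_leftKernel_iff]
  intro j hj
  have : (Finset.univ.filter fun l : Fin n => (Pi.single i 1 : Fin n → ZMod 2) l = 1) = {i} := by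
    ext l
    by_cases hl : l = i
    · subst hl; simp
    · simp [hl]
  rw [this, Finset.inter_singleton_of_notMem (h j hj)]
  simp

theorem not_zeroRow_of_rank_eq (hn : 2 ≤ n) {σ : ColumnOrder n k} {m : ℕ}
    (h : (firstColumns σ m).rank = nStar n k) (i : Fin n) : ¬ ZeroRow σ m i := by
  intro hi
  have hs := single_mem_leftKernel hi
  have hr := rank_add_finrank_leftKernel σ m
  rw [h, nStar] at hr
  by_cases hk : Even k
  · rw [if_pos hk] at hr
    have h1 : Module.finrank (ZMod 2) (leftKernel σ m) = 1 := by omega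
    have hv : (⟨1, one_mem_leftKernel hk σ m⟩ : leftKernel σ m) ≠ 0 := by
      intro h0
      have := congrFun (congrArg Subtype.val h0) i
      simp at this
    obtain ⟨c, hc⟩ := (finrank_eq_one_iff_of_nonzero' _ hv).1 h1 ⟨_, hs⟩
    have : Nontrivial (Fin n) := Fin.nontrivial_iff_two_le.2 hn
    obtain ⟨l, hl⟩ := exists_ne i
    have e1 := congrFun (congrArg Subtype.val hc) i
    have e2 := congrFun (congrArg Subtype.val hc) l
    simp [hl] at e1 e2
    rw [e1] at e2
    exact one_ne_zero e2
  · rw [if_neg hk] at hr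
    have h1 : Module.finrank (ZMod 2) (leftKernel σ m) = 0 := by omega
    rw [Submodule.finrank_eq_zero] at h1
    rw [h1, Submodule.mem_bot] at hs
    have := congrFun hs i
    simp at this

theorem rank_eq_nStar (hn : 1 ≤ n) {σ : ColumnOrder n k} {m : ℕ}
    (h : ∀ S : Finset (Fin n), (Odd k ∨ 2 * S.card ≤ n) → KernelSet σ m S → S = ∅) :
    (firstColumns σ m).rank = nStar n k := by
  have hz : ∀ a : ZMod 2, ¬ a = 1 → a = 0 := by decide
  have hzero (x : Fin n → ZMod 2) (hx : x ∈ leftKernel σ m)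
      (hS : Odd k ∨ 2 * (Finset.univ.filter fun i => x i = 1).card ≤ n) : x = 0 := by
    have := h _ hS ((mem_leftKernel_iff σ m x).1 hx)
    funext i
    refine hz _ fun hi => ?_
    have hi' : i ∈ Finset.univ.filter fun i => x i = 1 := by simpa using hi
    rw [this] at hi'
    simp at hi'
  have hr := rank_add_finrank_leftKernel σ m
  rw [nStar]
  by_cases hk : Even k
  · have hspan : leftKernel σ m = Submodule.span (ZMod 2) {1} := by
      refine le_antisymm (fun x hx => ?_) ?_
      · rw [Submodule.mem_span_singleton]
        by_cases hS : 2 * (Finset.univ.filter fun i => x i = 1).card ≤ n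
        · exact ⟨0, by rw [zero_smul, hzero x hx (Or.inr hS)]⟩
        · -- the complement of a kernel set is a kernel set
          have hadd := Submodule.add_mem _ hx (one_mem_leftKernel hk σ m)
          have hc := Finset.card_filter_add_card_filter_not (s := (Finset.univ : Finset (Fin n)))
            (fun i => x i = 1)
          rw [Finset.card_univ, Fintype.card_fin] at hc
          have hsupp : (Finset.univ.filter fun i => (x + 1) i = 1)
              = Finset.univ.filter fun i => ¬ x i = 1 := by
            have hz' : ∀ a : ZMod 2, a + 1 = 1 ↔ ¬ a = 1 := by decide
            ext i
            simp [hz']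
          have h0 := hzero _ hadd (Or.inr (by rw [hsupp]; omega))
          refine ⟨1, ?_⟩
          have hz' : ∀ a : ZMod 2, a + 1 = 0 → 1 = a := by decide
          funext i
          simpa using hz' _ (congrFun h0 i)
      · rw [Submodule.span_singleton_le_iff_mem]
        exact one_mem_leftKernel hk σ m
    have hone : (1 : Fin n → ZMod 2) ≠ 0 := by
      intro h0
      have := congrFun h0 ⟨0, hn⟩
      simp at this
    rw [hspan, finrank_span_singleton hone] at hr
    rw [if_pos hk]
    omega
  · have hbot : leftKernel σ m = ⊥ := by
      rw [eq_bot_iff]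
      intro x hx
      rw [Submodule.mem_bot]
      exact hzero x hx (Or.inl (Nat.not_even_iff_odd.1 hk))
    rw [hbot, finrank_bot] at hr
    rw [if_neg hk]
    omega

theorem ZeroRow.anti {σ : ColumnOrder n k} {m m' : ℕ} {i : Fin n} (h : m ≤ m')
    (hz : ZeroRow σ m' i) : ZeroRow σ m i :=
  fun j hj => hz j (hj.trans_le h)

theorem KernelSet.anti {σ : ColumnOrder n k} {m m' : ℕ} {S : Finset (Fin n)} (h : m ≤ m')
    (hz : KernelSet σ m' S) : KernelSet σ m S :=
  fun j hj => hz j (hj.trans_le h)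

/-- The two hitting times agree if, for some times `m ≤ m'`, there are zero rows at time `m` and
none at time `m'`, all kernel sets at time `m` consist of zero rows, and no column from time `m` to
`m'` meets two of these zero rows. -/
theorem exists_isLeast_and_isLeast (hn : 2 ≤ n) {σ : ColumnOrder n k} {m m' : ℕ}
    (hker : ¬ ∃ S : Finset (Fin n), (Odd k ∨ 2 * S.card ≤ n) ∧ KernelSet σ m S ∧
      ∃ i ∈ S, ¬ ZeroRow σ m i)
    (hpair : ¬ ∃ i j : Fin n, i ≠ j ∧ ∃ p : Fin (n.choose k), m ≤ (p : ℕ) ∧ (p : ℕ) < m' ∧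
      (ZeroRow σ m i ∧ ZeroRow σ m j) ∧ i ∈ colSupp (σ p) ∧ j ∈ colSupp (σ p))
    (hlate : ¬ ∃ i, ZeroRow σ m' i) (hearly : ¬ ∀ i, ¬ ZeroRow σ m i) :
    ∃ t : ℕ, IsLeast {m : ℕ | numNonzeroRows (firstColumns σ m) = n} t ∧
      IsLeast {m : ℕ | (firstColumns σ m).rank = nStar n k} t := by
  classical
  simp only [numNonzeroRows_eq_iff]
  have hex : ∃ t, ∀ i, ¬ ZeroRow σ t i := ⟨m', not_exists.1 hlate⟩
  have hspec := Nat.find_spec hex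
  have hmin := fun {t} (ht : ∀ i, ¬ ZeroRow σ t i) => Nat.find_min' hex ht
  set t := Nat.find hex
  have htm' : t ≤ m' := hmin (not_exists.1 hlate)
  have hmt : m ≤ t := by
    by_contra hlt
    exact hearly fun i hi => hspec i (hi.anti (not_le.1 hlt).le)
  refine ⟨t, ⟨hspec, fun s hs => hmin hs⟩, ?_, fun s hs => hmin (not_zeroRow_of_rank_eq hn hs)⟩
  refine rank_eq_nStar (by omega) fun S hS hkS => ?_
  by_contra hne
  obtain ⟨i, hi⟩ := Finset.nonempty_iff_ne_empty.2 hne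
  have hzero : ∀ j ∈ S, ZeroRow σ m j := by
    intro j hj
    by_contra hz
    exact hker ⟨S, hS, hkS.anti hmt, j, hj, hz⟩
  have hit := hspec i
  simp only [ZeroRow, not_forall, not_not] at hit
  obtain ⟨p, hpt, hip⟩ := hit
  have hmp : m ≤ (p : ℕ) := by
    by_contra hlt
    exact hzero i hi p (not_le.1 hlt) hip
  have hmem : i ∈ colSupp (σ p) ∩ S := Finset.mem_inter.2 ⟨hip, hi⟩
  have hcard : 1 < (colSupp (σ p) ∩ S).card := by
    have h0 := Finset.card_pos.2 ⟨i, hmem⟩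
    obtain ⟨r, hr⟩ := hkS p hpt
    omega
  obtain ⟨j, hj, hji⟩ := Finset.exists_mem_ne hcard i
  obtain ⟨hjp, hjS⟩ := Finset.mem_inter.1 hj
  exact hpair ⟨i, j, hji.symm, p, hmp, hpt.trans_le htm', ⟨hzero i hi, hzero j hjS⟩, hip, hjp⟩

end LinearAlgebra

/-! ### The two times and the limit -/

/-- A time, close to `(n / k) * log n` from below, at which about `√(log n)` rows are expected to be
zero: sufficiently many for one to exist with high probability, and sufficiently few for the first
moment bound on kernel sets. -/
noncomputable def earlyTime (n k : ℕ) : ℕ :=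
  ⌊n * (Real.log n - Real.log √(Real.log n)) / k⌋₊ + 2

/-- A time by which all rows are nonzero with high probability. -/
noncomputable def lateTime (n : ℕ) : ℕ := ⌈2 * (n * Real.log n)⌉₊

/-- A bound on the probability that the hitting times differ, as a function of `L = log n`. -/
noncomputable def failureBound (k : ℕ) (L : ℝ) : ℝ :=
  (Real.exp (4 * √L * Real.exp (k * Real.exp k)) * (2 * k ^ 2 * L * Real.exp (-L))
    + 4 * (Real.exp 1 * L * Real.exp (-(1 / 4 ^ k * (L - Real.log √L) / k))))
    + (6 * k ^ 2 * (L ^ 2 * Real.exp (-L)) + (Real.exp (-L) + Real.exp 3 / √L))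

theorem tendsto_mul_exp_neg_log_sqrt {a : ℝ} (ha : 0 < a) :
    Tendsto (fun L : ℝ => L * Real.exp (-(a * (L - Real.log √L)))) atTop (𝓝 0) := by
  have h1 : Tendsto (fun L : ℝ => L * Real.exp (-(a / 2 * L))) atTop (𝓝 0) := by
    have h := (Real.tendsto_pow_mul_exp_neg_atTop_nhds_zero 1).comp
      (tendsto_id.const_mul_atTop (by positivity : 0 < a / 2))
    have h2 := h.const_mul (2 / a)
    rw [mul_zero] at h2
    refine h2.congr fun L => ?_
    simp only [Function.comp, id, pow_one]
    field_simp
  refine squeeze_zero' ?_ ?_ h1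
  · filter_upwards [eventually_ge_atTop 0] with L hL
    positivity
  · filter_upwards [eventually_gt_atTop 0] with L hL
    have : Real.log √L ≤ L / 2 := by
      rw [Real.log_sqrt hL.le]
      have := Real.log_le_self hL.le
      linarith
    exact mul_le_mul_of_nonneg_left (Real.exp_le_exp.2 (by nlinarith)) hL.le

theorem tendsto_exp_mul_sqrt_mul_exp_neg (D : ℝ) :
    Tendsto (fun L : ℝ => Real.exp (D * √L) * (L * Real.exp (-L))) atTop (𝓝 0) := by
  have h1 : Tendsto (fun u : ℝ => Real.exp (D * u) * (u ^ 2 * Real.exp (-u ^ 2))) atTop (𝓝 0) := by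
    refine squeeze_zero' (Eventually.of_forall fun u => by positivity) ?_
      (Real.tendsto_pow_mul_exp_neg_atTop_nhds_zero 2)
    filter_upwards [eventually_ge_atTop (D + 1), eventually_ge_atTop 0] with u hu hu0
    calc Real.exp (D * u) * (u ^ 2 * Real.exp (-u ^ 2)) = u ^ 2 * Real.exp (D * u - u ^ 2) := by
          rw [sub_eq_add_neg, Real.exp_add]; ring
      _ ≤ _ := by
          gcongr
          nlinarith
  refine (h1.comp Real.tendsto_sqrt_atTop).congr' ?_
  filter_upwards [eventually_ge_atTop 0] with L hL
  simp only [Function.comp, Real.sq_sqrt hL]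

theorem tendsto_failureBound {k : ℕ} (hk : 0 < k) :
    Tendsto (failureBound k) atTop (𝓝 0) := by
  have hk0 : (0 : ℝ) < k := by exact_mod_cast hk
  have h1 := (tendsto_exp_mul_sqrt_mul_exp_neg (4 * Real.exp (k * Real.exp k))).const_mul
    (2 * (k : ℝ) ^ 2)
  have h2 := (tendsto_mul_exp_neg_log_sqrt (a := 1 / 4 ^ k / k) (by positivity)).const_mul
    (4 * Real.exp 1)
  have h3 := (Real.tendsto_pow_mul_exp_neg_atTop_nhds_zero 2).const_mul (6 * (k : ℝ) ^ 2)
  have h4 := Real.tendsto_exp_neg_atTop_nhds_zero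
  have h5 := Real.tendsto_sqrt_atTop.const_div_atTop (Real.exp 3)
  have h := (h1.add h2).add (h3.add (h4.add h5))
  simp only [mul_zero, add_zero] at h
  refine h.congr fun L => ?_
  simp only [failureBound]
  congr 1
  congr 1
  · rw [mul_right_comm 4 (√L)]; ring
  · rw [mul_div_right_comm]; ring

theorem pow_three_le_choose {n k : ℕ} (hk : 3 ≤ k) (hkn : 4 * k ≤ n) :
    (n : ℝ) ^ 3 ≤ 8 * k.factorial * n.choose k := by
  have h := Nat.pow_le_choose k n (α := ℝ)
  have hf : (0 : ℝ) < k.factorial := by exact_mod_cast k.factorial_pos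
  rw [div_le_iff₀ hf] at h
  have h1 : (n : ℝ) / 2 ≤ (n + 1 - k : ℕ) := by
    rw [Nat.cast_sub (by omega)]
    have : 4 * (k : ℝ) ≤ n := by exact_mod_cast hkn
    have : (0 : ℝ) ≤ n := by positivity
    push_cast
    linarith
  have h2 : (1 : ℝ) ≤ (n : ℝ) / 2 := by
    have : (2 : ℝ) ≤ n := by exact_mod_cast (by omega : 2 ≤ n)
    linarith
  have h3 : ((n : ℝ) / 2) ^ 3 ≤ (n.choose k : ℝ) * k.factorial := by
    calc ((n : ℝ) / 2) ^ 3 ≤ ((n : ℝ) / 2) ^ k := pow_le_pow_right₀ h2 hk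
      _ ≤ ((n + 1 - k : ℕ) : ℝ) ^ k := by gcongr
      _ ≤ _ := by exact_mod_cast h
  nlinarith

theorem earlyTime_eq (n k : ℕ) : earlyTime n k = earlyTime n k - 1 + 1 := by
  rw [earlyTime]; omega

theorem mul_le_mul_earlyTime {n k : ℕ} (hk : 0 < k) :
    n * (Real.log n - Real.log √(Real.log n)) ≤ k * (earlyTime n k - 1 : ℕ) := by
  have hk0 : (0 : ℝ) < k := by exact_mod_cast hk
  have h : earlyTime n k - 1 = ⌊n * (Real.log n - Real.log √(Real.log n)) / k⌋₊ + 1 := rfl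
  rw [h, mul_comm (k : ℝ), ← div_le_iff₀ hk0]
  push_cast
  exact (Nat.lt_floor_add_one _).le

theorem mul_earlyTime_le {n k : ℕ} (hk : 0 < k)
    (hn : Real.log √(Real.log n) ≤ Real.log n) :
    (k : ℝ) * (earlyTime n k - 1 : ℕ) ≤ n * (Real.log n - Real.log √(Real.log n)) + k := by
  have hk0 : (0 : ℝ) < k := by exact_mod_cast hk
  have h : earlyTime n k - 1 = ⌊n * (Real.log n - Real.log √(Real.log n)) / k⌋₊ + 1 := rfl
  have h2 := Nat.floor_le (a := n * (Real.log n - Real.log √(Real.log n)) / k) (by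
    have : 0 ≤ Real.log n - Real.log √(Real.log n) := by linarith
    positivity)
  rw [le_div_iff₀ hk0] at h2
  rw [h]
  push_cast
  linarith

theorem exp_neg_two_mul_le {n k m : ℕ} {L W : ℝ} (hn : Real.exp L = n) (hW : 0 < W)
    (hlow : n * (L - Real.log W) ≤ k * m) :
    Real.exp (-(2 * k * m / n)) ≤ W ^ 2 / n ^ 2 := by
  have hn0 : (0 : ℝ) < n := hn ▸ Real.exp_pos L
  have e : W ^ 2 / n ^ 2 = Real.exp (-(2 * (L - Real.log W))) := by
    rw [show -(2 * (L - Real.log W)) = (Real.log W + Real.log W) - (L + L) by ring,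
      Real.exp_sub, Real.exp_add, Real.exp_add, Real.exp_log hW, hn, sq, sq]
  rw [e, Real.exp_le_exp, neg_le_neg_iff, le_div_iff₀ hn0]
  linarith

/-- With the expected number of zero rows bounded below by a multiple of `W`, the second moment
method yields a zero row. -/
theorem prob_forall_not_zeroRow_le_div {n k m : ℕ} {L W : ℝ} (hkn : k + 1 < n)
    (hn : Real.exp L = n) (hW : 1 ≤ W) (hnm : n * m ≤ n.choose k)
    (hup : (k : ℝ) * m ≤ n * (L - Real.log W) + 2 * k) (hL : 2 * k + (k + 1) * (L + 3) ≤ 3 * n) :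
    prob (fun σ : ColumnOrder n k => ∀ i, ¬ ZeroRow σ m i) ≤ Real.exp 3 / W := by
  have hW0 : 0 < W := by linarith
  have hd : (0 : ℝ) < n - k - 1 := by
    have : (k : ℝ) + 1 < n := by exact_mod_cast hkn
    linarith
  have hmean : W / Real.exp 3 ≤ n * zeroRowProb n k m := by
    have h1 : (k : ℝ) * m / (n - k - 1) ≤ L - Real.log W + 3 := by
      rw [div_le_iff₀ hd]
      have h2 : 0 ≤ (k + 1) * Real.log W := mul_nonneg (by positivity) (Real.log_nonneg hW)
      linarith
    calc W / Real.exp 3 = Real.exp L * Real.exp (-(L - Real.log W + 3)) := by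
          rw [← Real.exp_add, show L + -(L - Real.log W + 3) = Real.log W - 3 by ring,
            Real.exp_sub, Real.exp_log hW0]
      _ ≤ n * Real.exp (-(k * m / (n - k - 1))) := by rw [hn]; gcongr
      _ ≤ _ := by
          gcongr
          exact exp_neg_le_zeroRowProb (by omega) hkn hnm
  have hmean0 : 0 < W / Real.exp 3 := by positivity
  refine (prob_forall_not_zeroRow_le ((Nat.le_mul_of_pos_left m (by omega)).trans hnm)
    (hmean0.trans_le hmean)).trans ?_
  rw [← one_div_div W]
  exact one_div_le_one_div_of_le hmean0 hmean

/-- The bound on the failure probability for all `n` that are large in terms of `k`. -/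
theorem one_sub_failureBound_le {n k : ℕ} (hk : 3 ≤ k) (hkn : 4 * k ≤ n)
    (hL : Real.exp 1 ≤ Real.log n) (hC : (8 * k.factorial + 4 * (k + 1)) * Real.log n ≤ n)
    (hy : Real.exp 1 * Real.log n
      * Real.exp (-(1 / 4 ^ k * (Real.log n - Real.log √(Real.log n)) / k)) ≤ 1 / 2) :
    1 - failureBound k (Real.log n) ≤ prob (fun σ : ColumnOrder n k => ∃ t : ℕ,
      IsLeast {m : ℕ | numNonzeroRows (firstColumns σ m) = n} t ∧
        IsLeast {m : ℕ | (firstColumns σ m).rank = nStar n k} t) := by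
  have hn0 : (0 : ℝ) < n := by exact_mod_cast (by omega : 0 < n)
  have hk3 : (3 : ℝ) ≤ k := by exact_mod_cast hk
  have hkn' : 4 * (k : ℝ) ≤ n := by exact_mod_cast hkn
  have hlow := mul_le_mul_earlyTime (n := n) (by omega : 0 < k)
  have hupp := mul_earlyTime_le (n := n) (by omega : 0 < k)
  have hm1 := earlyTime_eq n k
  set L := Real.log n with hLdef
  set m := earlyTime n k
  have hexp : Real.exp L = n := Real.exp_log hn0
  have hL2 : 2 ≤ L := by
    have := Real.add_one_le_exp (1 : ℝ)
    linarith
  have hL0 : 0 < L := by linarith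
  have hlogL : 1 ≤ Real.log L := (Real.le_log_iff_exp_le hL0).2 hL
  have hW : 0 < √L := Real.sqrt_pos.2 hL0
  have hlogW : Real.log √L = Real.log L / 2 := Real.log_sqrt hL0.le
  have hlogLL : Real.log L ≤ L := Real.log_le_self hL0.le
  have hf : (0 : ℝ) < k.factorial := by exact_mod_cast k.factorial_pos
  have hkL : 4 * (k + 1) * L ≤ n := by
    have : 0 ≤ 8 * (k.factorial : ℝ) * L := by positivity
    linarith
  have hfL : 8 * (k.factorial : ℝ) * L ≤ n := by
    have : 0 ≤ 4 * ((k : ℝ) + 1) * L := by positivity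
    linarith
  specialize hupp (by linarith)
  have hm1' : (m : ℝ) = ((m - 1 : ℕ) : ℝ) + 1 := by exact_mod_cast hm1
  have hnL : n ≤ n * L := le_mul_of_one_le_right hn0.le (by linarith)
  have hup : (k : ℝ) * (m - 1 : ℕ) ≤ n * L := by
    have : n * (1 / 2) ≤ n * Real.log √L := by gcongr; linarith
    linarith
  have hmL : (m : ℝ) ≤ n * L := by
    have : 3 * ((m - 1 : ℕ) : ℝ) ≤ k * (m - 1 : ℕ) := by gcongr
    rw [hm1']
    linarith
  have hlow' : n * (L - Real.log √L) ≤ k * m := by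
    rw [hm1']
    linarith
  set m' := lateTime n with hm'
  have hm'low : 2 * (n * L) ≤ m' := Nat.le_ceil _
  have hm'up : (m' : ℝ) ≤ 3 * (n * L) := by
    have := (Nat.ceil_lt_add_one (a := 2 * (n * L)) (by positivity)).le
    rw [hm', lateTime]
    linarith
  have hM : (n : ℝ) * (n * L) ≤ n.choose k := by
    have h1 := pow_three_le_choose hk hkn
    have h3 : (8 * k.factorial) * ((n : ℝ) * (n * L)) ≤ (8 * k.factorial) * n.choose k := by
      calc (8 * k.factorial) * ((n : ℝ) * (n * L)) = n ^ 2 * (8 * k.factorial * L) := by ring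
        _ ≤ n ^ 2 * n := by gcongr
        _ = n ^ 3 := by ring
        _ ≤ _ := h1
    exact le_of_mul_le_mul_left h3 (by positivity)
  have hnm : n * m ≤ n.choose k := by
    have : (n : ℝ) * m ≤ n.choose k := (by gcongr : (n : ℝ) * m ≤ n * (n * L)).trans hM
    exact_mod_cast this
  have h2m : 2 * m ≤ n.choose k := (Nat.mul_le_mul_right m (by omega)).trans hnm
  have hm'M : m' ≤ n.choose k := by
    have : (m' : ℝ) ≤ n.choose k := by
      refine hm'up.trans (le_trans ?_ hM)
      gcongr
      linarith
    exact_mod_cast this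
  have hinv : Real.exp (-L) = 1 / n := by rw [Real.exp_neg, hexp, one_div]
  have b1 := prob_exists_kernelSet_le (by omega) hkn h2m hexp (by linarith) hW hmL hlow hup hy
  have b2 : _ ≤ 6 * k ^ 2 * (L ^ 2 * Real.exp (-L)) :=
    (prob_exists_pair_le (by omega) (by omega) h2m hm'M).trans (by
      have h1 := exp_neg_two_mul_le hexp hW hlow'
      rw [Real.sq_sqrt hL0.le] at h1
      calc m' * (2 * (k : ℝ) ^ 2 * Real.exp (-(2 * k * m / n)))
          ≤ (3 * (n * L)) * (2 * (k : ℝ) ^ 2 * (L / n ^ 2)) := by gcongr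
        _ = _ := by rw [hinv]; field_simp; ring)
  have b3 : _ ≤ Real.exp (-L) :=
    (prob_exists_zeroRow_le (by omega : k ≤ n) hm'M).trans (by
      have h1 : 2 * L ≤ k * m' / n := by
        rw [le_div_iff₀ hn0]
        have : 1 * (m' : ℝ) ≤ k * m' := by gcongr; linarith
        linarith
      calc n * Real.exp (-(k * m' / n)) ≤ n * Real.exp (-(2 * L)) := by gcongr
        _ = _ := by
          rw [show -(2 * L) = -L + -L by ring, Real.exp_add, hinv]
          field_simp)
  have b4 := prob_forall_not_zeroRow_le_div (m := m) (by omega : k + 1 < n) hexp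
    (Real.one_le_sqrt.2 (by linarith : 1 ≤ L)) hnm (by rw [hm1']; linarith) (by nlinarith)
  refine le_trans ?_ (one_sub_prob_not_le _)
  refine sub_le_sub_left ?_ 1
  refine le_trans (prob_mono fun σ hσ => ?_) ((prob_or_le _ _).trans (add_le_add (b1.trans ?_)
    ((prob_or_le _ _).trans (add_le_add b2 ((prob_or_le _ _).trans (add_le_add b3 b4))))))
  · by_contra hcon
    simp only [not_or] at hcon
    exact hσ (exists_isLeast_and_isLeast (by omega) hcon.1 hcon.2.1 hcon.2.2.1 hcon.2.2.2)
  · rw [hinv, mul_one_div]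

theorem theorem3 (k : ℕ) (hk : 3 ≤ k) :
    Tendsto
      (fun n : ℕ => (randomOrder n k).real
        {σ : ColumnOrder n k | ∃ t : ℕ,
          IsLeast {m : ℕ | numNonzeroRows (firstColumns σ m) = n} t ∧
          IsLeast {m : ℕ | (firstColumns σ m).rank = nStar n k} t})
      atTop (𝓝 1) := by
  have hk0 : (0 : ℝ) < k := by exact_mod_cast (by omega : 0 < k)
  have hlog : Tendsto (fun n : ℕ => Real.log n) atTop atTop :=
    Real.tendsto_log_atTop.comp tendsto_natCast_atTop_atTop
  have hlow : Tendsto (fun n : ℕ => 1 - failureBound k (Real.log n)) atTop (𝓝 1) := by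
    simpa using ((tendsto_failureBound (by omega : 0 < k)).comp hlog).const_sub 1
  have hC : ∀ᶠ n : ℕ in atTop,
      (8 * (k.factorial : ℝ) + 4 * (k + 1)) * Real.log n ≤ n := by
    have hpos : (0 : ℝ) < 8 * k.factorial + 4 * (k + 1) := by positivity
    have h := (Real.isLittleO_log_id_atTop.bound (inv_pos.2 hpos)).and (eventually_ge_atTop 1)
    filter_upwards [tendsto_natCast_atTop_atTop.eventually h] with n hn
    obtain ⟨h1, h2⟩ := hn
    rw [Real.norm_of_nonneg (Real.log_nonneg h2), id, Real.norm_of_nonneg (by positivity)] at h1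
    rwa [inv_mul_eq_div, le_div_iff₀ hpos, mul_comm] at h1
  have hy : ∀ᶠ n : ℕ in atTop, Real.exp 1 * Real.log n
      * Real.exp (-(1 / 4 ^ k * (Real.log n - Real.log √(Real.log n)) / k)) ≤ 1 / 2 := by
    have h := ((tendsto_mul_exp_neg_log_sqrt (a := 1 / 4 ^ k / k) (by positivity)).const_mul
      (Real.exp 1)).comp hlog
    rw [mul_zero] at h
    filter_upwards [h.eventually_le_const (by norm_num : (0 : ℝ) < 1 / 2)] with n hn
    refine le_trans (le_of_eq ?_) hn
    simp only [Function.comp]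
    rw [mul_div_right_comm, mul_assoc]
  refine tendsto_of_tendsto_of_tendsto_of_le_of_le' hlow tendsto_const_nhds ?_ ?_
  · filter_upwards [eventually_ge_atTop (4 * k), hlog.eventually_ge_atTop (Real.exp 1), hC, hy]
      with n h1 h2 h3 h4
    rw [randomOrder_real_eq_prob]
    exact one_sub_failureBound_le hk h1 h2 h3 h4
  · filter_upwards with n
    rw [randomOrder_real_eq_prob]
    exact prob_le_one _
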